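/- Let $H$ be a complex Hilbert space, with inner product $\langle\cdot,\cdot\rangle$ antilinear on the left, and let $y\mapsto\overline{y}$ be a selfadjoint involution on $H$, i.e. a bounded linear selfadjoint operator whose square is the identity. Let $q\in(-1,1)$. Let $B(n)$ be the group of permutations $\sigma$ of $\{\pm1,\dots,\pm n\}$ with $\sigma(-k)=-\sigma(k)$, put $\pi_i=(i,i+1)(-i,-i-1)$ for $1\le i\le n-1$, $\overline{\pi}_n=(n,-n)$ and, for $n\ge2$, $\widehat{\pi}_{n-1}=\overline{\pi}_n\pi_{n-1}\overline{\pi}_n$. Let $D(n)\subset B(n)$ be the subgroup generated by $\pi_1,\dots,\pi_{n-1},\widehat{\pi}_{n-1}$ (trivial for $n\le1$), and let $\ell(\sigma)$ be the length of $\sigma\in D(n)$ with respect to these generators. $D(n)$ acts on the $n$-fold tensor power $H^{\otimes n}$: $\pi_i$ exchanges the $i$-th and $(i+1)$-st factors, and $\widehat{\pi}_{n-1}(x_1\otimes\cdots\otimes x_n)=x_1\otimes\cdots\otimes x_{n-2}\otimes\overline{x}_n\otimes\overline{x}_{n-1}$. On the algebraic full Fock space $\mathcal F=\bigoplus_{n\ge0}H^{\otimes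 n}$ (no completions taken), with $H^{\otimes0}=\mathbb C\Omega$ and the standard inner product $\langle\cdot,\cdot\rangle_0$ determined by $\langle x_1\otimes\cdots\otimes x_m,y_1\otimes\cdots\otimes y_n\rangle_0=\delta_{m,n}\prod_i\langle x_i,y_i\rangle$, put $$\langle f,g\rangle_q=\langle f,\widehat P_q g\rangle_0,\qquad \widehat P_q=\bigoplus_{n\ge0}\ \sum_{\sigma\in D(n)}q^{\ell(\sigma)}\sigma\qquad(0^0=1).$$ For $x\in H$ let $d_q^*(x)$ be the linear operator on $\mathcal F$ with $d_q^*(x)\Omega=x$ and $d_q^*(x)(x_1\otimes\cdots\otimes x_n)=x\otimes x_1\otimes\cdots\otimes x_n$, let $d_q(x)$ be its adjoint with respect to $\langle\cdot,\cdot\rangle_q$, and let $G_q(x)=d_q(x)+d_q^*(x)$. Let $x\in H$ with $\|x\|=1$ and $\overline{x}=x$ or $\overline{x}=-x$. Then $\langle\cdot,\cdot\rangle_q$ is an inner product on $\mathcal F$ and $d_q(x)$ exists. Moreover, let $(P_n)_{n\ge0}$ be the polynomials with $P_0=1$, $P_1=t$, $P_2=t^2-1$ and $$tP_n=P_{n+1}+[n]_q(1+q^{n-1})P_{n-1}\quad(n\ge2),\qquad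 [n]_q=1+q+\cdots+q^{n-1}.$$ There is exactly one probability measure $\mu_q$ on $\mathbb R$ with finite moments of all orders whose monic orthogonal polynomials are the $P_n$, and $\mu_q$ is the probability distribution of $G_q(x)$ in the vacuum state: $\mu_q$ is compactly supported, $$\langle\Omega,G_q(x)^n\Omega\rangle_q=\int_{\mathbb R}t^n\,\mu_q(dt)\qquad(n\ge0),$$ and $\mu_q$ is the only probability measure on $\mathbb R$ with these moments. -/

import Mathlib

open scoped TensorProduct DirectSum
open MeasureTheory

noncomputable section

namespace TypeDFock

/-! ### The Coxeter groups of type B and type D -/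

/-- The set `{±1, …, ±n}`: the pair `(k, s)` stands for the signed number `s · (k + 1)`. -/
abbrev SignedIndex (n : ℕ) : Type := Fin n × ℤˣ

/-- The group `B(n)` of the permutations `σ` of `{±1, …, ±n}` such that `σ (-k) = -σ k`. -/
def typeB (n : ℕ) : Subgroup (Equiv.Perm (SignedIndex n)) where
  carrier := {σ | ∀ k s, σ (k, -s) = ((σ (k, s)).1, -(σ (k, s)).2)}
  one_mem' := by intro k s; rfl
  mul_mem' := by
    intro a b ha hb k s
    simp only [Set.mem_ofPred_eq, Equiv.Perm.mul_apply] at ha hb ⊢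
    rw [hb, ha]
  inv_mem' := by
    intro a ha k s
    simp only [Set.mem_ofPred_eq] at ha ⊢
    rw [Equiv.Perm.inv_eq_iff_eq, ha]
    simp

/-- The permutation `(i, j)(-i, -j)`; the generator `π_i` is `swapB i (i+1)`. -/
def swapB {n : ℕ} (i j : Fin n) : typeB n :=
  ⟨Equiv.prodCongr (Equiv.swap i j) (Equiv.refl ℤˣ), fun _ _ => rfl⟩

/-- The permutation `(i, -i)`; `π̄_n` is `flipB` of the last index. -/
def flipB {n : ℕ} (i : Fin n) : typeB n :=
  ⟨{ toFun := fun p => (p.1, if p.1 = i then -p.2 else p.2)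
     invFun := fun p => (p.1, if p.1 = i then -p.2 else p.2)
     left_inv := by
      rintro ⟨k, s⟩
      by_cases h : k = i <;> simp [h]
     right_inv := by
      rintro ⟨k, s⟩
      by_cases h : k = i <;> simp [h] },
   by
    intro k s
    by_cases h : k = i <;> simp [h]⟩

/-- The Coxeter generators of `D(n)`: `π_1, …, π_{n-1}` and, for `n ≥ 2`,
`π̂_{n-1} = π̄_n π_{n-1} π̄_n`. There are none for `n ≤ 1`. -/
def genD (n : ℕ) : Set (typeB n) :=
  {σ | ∃ (i : ℕ) (h : i + 1 < n), σ = swapB ⟨i, by omega⟩ ⟨i + 1, h⟩} ∪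
  {σ | ∃ (i : ℕ) (h : i + 2 = n),
      σ = flipB ⟨i + 1, by omega⟩ * swapB ⟨i, by omega⟩ ⟨i + 1, by omega⟩ *
        flipB ⟨i + 1, by omega⟩}

/-- The Coxeter group `D(n)`. -/
def typeD (n : ℕ) : Subgroup (typeB n) := Subgroup.closure (genD n)

instance (n : ℕ) : Fintype (typeD n) := Fintype.ofFinite _

/-- The length of `σ`: the minimal number of generators of `D(n)` (with repetition allowed) whose
product is `σ`. -/
def lengthD {n : ℕ} (σ : typeD n) : ℕ :=
  sInf {k | ∃ w : List (typeB n), w.length = k ∧ (∀ g ∈ w, g ∈ genD n) ∧ w.prod = (σ : typeB n)}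

/-- The permutation of `{1, …, n}` that underlies a signed permutation. -/
def absPerm {n : ℕ} (σ : typeB n) : Equiv.Perm (Fin n) where
  toFun k := ((σ : Equiv.Perm (SignedIndex n)) (k, 1)).1
  invFun k := ((σ⁻¹ : typeB n) : Equiv.Perm (SignedIndex n)) (k, 1) |>.1
  left_inv := by
    intro k
    have key : ∀ (τ : typeB n) (j : Fin n) (s : ℤˣ),
        ((τ : Equiv.Perm (SignedIndex n)) (j, s)).1 = (τ.1 (j, 1)).1 := by
      intro τ j s
      rcases Int.units_eq_one_or s with rfl | rfl
      · rfl
      · rw [τ.2 j 1]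
    have h := key σ⁻¹ (σ.1 (k, 1)).1 (σ.1 (k, 1)).2
    dsimp only
    rw [← h]
    simp
  right_inv := by
    intro k
    have key : ∀ (τ : typeB n) (j : Fin n) (s : ℤˣ),
        ((τ : Equiv.Perm (SignedIndex n)) (j, s)).1 = (τ.1 (j, 1)).1 := by
      intro τ j s
      rcases Int.units_eq_one_or s with rfl | rfl
      · rfl
      · rw [τ.2 j 1]
    have h := key σ ((σ⁻¹ : typeB n).1 (k, 1)).1 ((σ⁻¹ : typeB n).1 (k, 1)).2
    dsimp only
    rw [← h]
    simp

variable {H : Type*} [NormedAddCommGroup H] [InnerProductSpace ℂ H]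

/-- The action of a signed permutation on `H^{⊗n}`: with `x_{-k} := J x_k`, the `j`-th factor of
`σ (x_1 ⊗ ⋯ ⊗ x_n)` is `x_{σ⁻¹ j}`. On the generators, `π_i` exchanges the factors `i` and `i+1`,
and `π̂_{n-1}` replaces the last two factors `x_{n-1} ⊗ x_n` by `J x_n ⊗ J x_{n-1}`. -/
def action (J : H →L[ℂ] H) {n : ℕ} (σ : typeB n) : (⨂[ℂ]^n H) →ₗ[ℂ] (⨂[ℂ]^n H) :=
  PiTensorProduct.map (fun j : Fin n =>
      if (((σ⁻¹ : typeB n) : Equiv.Perm (SignedIndex n)) (j, 1)).2 = 1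
      then LinearMap.id else (J : H →ₗ[ℂ] H)) ∘ₗ
    (PiTensorProduct.reindex ℂ (fun _ : Fin n => H) (absPerm σ)).toLinearMap

/-- The symmetrizer `∑_{σ ∈ D(n)} q^{ℓ(σ)} σ` of type D on `H^{⊗n}`. -/
def symmetrizer (q : ℝ) (J : H →L[ℂ] H) (n : ℕ) : (⨂[ℂ]^n H) →ₗ[ℂ] (⨂[ℂ]^n H) :=
  ∑ σ : typeD n, ((q : ℂ) ^ lengthD σ) • action J (σ : typeB n)

/-! ### The inner product of the tensor powers -/

/-- The linear functional `y_1 ⊗ ⋯ ⊗ y_n ↦ ∏ ⟨x_i, y_i⟩`. -/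
def tensorInnerLeft {n : ℕ} (x : Fin n → H) : (⨂[ℂ]^n H) →ₗ[ℂ] ℂ :=
  PiTensorProduct.lift
    ((MultilinearMap.mkPiAlgebra ℂ (Fin n) ℂ).compLinearMap
      (fun i => (innerSL ℂ (x i) : H →ₗ[ℂ] ℂ)))

theorem tensorInnerLeft_tprod {n : ℕ} (x y : Fin n → H) :
    tensorInnerLeft x (PiTensorProduct.tprod ℂ y) = ∏ i, inner ℂ (x i) (y i) := by
  simp [tensorInnerLeft]

/-- For a fixed tensor `y`, the multilinear map `x ↦ conj ⟨x_1 ⊗ ⋯ ⊗ x_n, y⟩`. -/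
def tensorInnerRight {n : ℕ} (y : ⨂[ℂ]^n H) : MultilinearMap ℂ (fun _ : Fin n => H) ℂ where
  toFun x := starRingEnd ℂ (tensorInnerLeft x y)
  map_update_add' := by
    intro hdec x i a b
    obtain rfl : hdec = instDecidableEqFin n := Subsingleton.elim _ _
    have h : tensorInnerLeft (Function.update x i (a + b)) =
        tensorInnerLeft (Function.update x i a) + tensorInnerLeft (Function.update x i b) := by
      ext z
      simp only [LinearMap.compMultilinearMap_apply, LinearMap.add_apply, tensorInnerLeft_tprod]
      rw [← Finset.mul_prod_erase _ _ (Finset.mem_univ i),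
        ← Finset.mul_prod_erase _ _ (Finset.mem_univ i),
        ← Finset.mul_prod_erase _ _ (Finset.mem_univ i)]
      simp only [Function.update_self, inner_add_left, add_mul]
      congr 2 <;>
      · refine Finset.prod_congr rfl fun j hj => ?_
        simp [Finset.ne_of_mem_erase hj]
    rw [h]
    simp
  map_update_smul' := by
    intro hdec x i c a
    obtain rfl : hdec = instDecidableEqFin n := Subsingleton.elim _ _
    have h : tensorInnerLeft (Function.update x i (c • a)) =
        (starRingEnd ℂ c) • tensorInnerLeft (Function.update x i a) := by
      ext z
      simp only [LinearMap.compMultilinearMap_apply, LinearMap.smul_apply, tensorInnerLeft_tprod,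
        smul_eq_mul]
      rw [← Finset.mul_prod_erase _ _ (Finset.mem_univ i),
        ← Finset.mul_prod_erase _ _ (Finset.mem_univ i)]
      simp only [Function.update_self, inner_smul_left, mul_assoc]
      congr 2
      refine Finset.prod_congr rfl fun j hj => ?_
      simp [Finset.ne_of_mem_erase hj]
    rw [h]
    simp

/-- The sesquilinear form on `H^{⊗n}`, antilinear on the left, with
`⟨x_1 ⊗ ⋯ ⊗ x_n, y_1 ⊗ ⋯ ⊗ y_n⟩ = ∏ ⟨x_i, y_i⟩` (see `tensorInner_tprod`). -/
def tensorInner {n : ℕ} : (⨂[ℂ]^n H) →ₗ⋆[ℂ] (⨂[ℂ]^n H) →ₗ[ℂ] ℂ :=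
  LinearMap.mk₂'ₛₗ (starRingEnd ℂ) (RingHom.id ℂ)
    (fun f g => starRingEnd ℂ (PiTensorProduct.lift (tensorInnerRight g) f))
    (by intro f₁ f₂ g; simp)
    (by intro c f g; simp)
    (by
      intro f g₁ g₂
      have h : tensorInnerRight (g₁ + g₂) = tensorInnerRight g₁ + tensorInnerRight g₂ := by
        ext x; simp [tensorInnerRight]
      rw [h]; simp)
    (by
      intro c f g
      have h : tensorInnerRight (c • g) = (starRingEnd ℂ c) • tensorInnerRight g := by
        ext x; simp [tensorInnerRight]
      rw [h]; simp)

theorem tensorInner_tprod {n : ℕ} (x y : Fin n → H) :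
    tensorInner (PiTensorProduct.tprod ℂ x) (PiTensorProduct.tprod ℂ y) =
      ∏ i, inner ℂ (x i) (y i) := by
  simp [tensorInner, tensorInnerRight, tensorInnerLeft_tprod]

/-! ### The Fock space of type D -/

variable (H) in
/-- The algebraic full Fock space `⨁ₙ H^{⊗n}`. -/
abbrev Fock : Type _ := ⨁ n : ℕ, ⨂[ℂ]^n H

/-- The vacuum vector `Ω`. -/
def vacuum : Fock H :=
  DirectSum.lof ℂ ℕ (fun n => ⨂[ℂ]^n H) 0 (PiTensorProduct.tprod ℂ Fin.elim0)

/-- The deformed form `⟨f, g⟩_q = ⟨f, P_q g⟩_0 = ∑ₙ ⟨f_n, P_q^{(n)} g_n⟩_0` on the Fock space,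
antilinear on the left. -/
def fockInner (q : ℝ) (J : H →L[ℂ] H) : Fock H →ₗ⋆[ℂ] Fock H →ₗ[ℂ] ℂ where
  toFun f := DirectSum.toModule ℂ ℕ ℂ (fun n => tensorInner (f n) ∘ₗ symmetrizer q J n)
  map_add' := by
    intro f₁ f₂
    ext n : 1
    ext
    simp
  map_smul' := by
    intro c f
    ext n : 1
    ext
    simp [DirectSum.smul_apply]

/-- The map `x_1 ⊗ ⋯ ⊗ x_n ↦ x ⊗ x_1 ⊗ ⋯ ⊗ x_n`. -/
def tensorCons (x : H) (n : ℕ) : (⨂[ℂ]^n H) →ₗ[ℂ] (⨂[ℂ]^(n + 1) H) :=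
  PiTensorProduct.lift
    ((PiTensorProduct.tprod ℂ : MultilinearMap ℂ (fun _ : Fin (n + 1) => H) _).curryLeft x)

/-- The creation operator `d_q^*(x) = l^*(x)`. -/
def creation (x : H) : Fock H →ₗ[ℂ] Fock H :=
  DirectSum.toModule ℂ ℕ (Fock H)
    (fun n => DirectSum.lof ℂ ℕ (fun n => ⨂[ℂ]^n H) (n + 1) ∘ₗ tensorCons x n)

/-- `A` is an adjoint of the creation operator of `x` for `⟨·, ·⟩_q`. -/
def IsAdjointOfCreation (q : ℝ) (J : H →L[ℂ] H) (x : H) (A : Fock H →ₗ[ℂ] Fock H) : Prop :=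
  ∀ f g : Fock H, fockInner q J f (A g) = fockInner q J (creation x f) g

open Classical in
/-- The annihilation operator `d_q(x)`: the adjoint of `d_q^*(x)` for `⟨·, ·⟩_q`
(and `0` if there were none). -/
def annihilation (q : ℝ) (J : H →L[ℂ] H) (x : H) : Fock H →ₗ[ℂ] Fock H :=
  if h : ∃ A, IsAdjointOfCreation q J x A then h.choose else 0

/-- The Gaussian operator `G_q(x) = d_q(x) + d_q^*(x)` of type D. -/
def gaussian (q : ℝ) (J : H →L[ℂ] H) (x : H) : Module.End ℂ (Fock H) :=
  annihilation q J x + creation x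

/-- `μ` has finite moments of all orders, and they are the vacuum moments `⟨Ω, Gⁿ Ω⟩_q` of
`G = G_q(x)`. -/
def HasVacuumMoments (q : ℝ) (J : H →L[ℂ] H) (x : H) (μ : Measure ℝ) : Prop :=
  ∀ n : ℕ, Integrable (fun t : ℝ => t ^ n) μ ∧
    ((∫ t, t ^ n ∂μ : ℝ) : ℂ) = fockInner q J vacuum ((gaussian q J x ^ n) vacuum)

/-- `μ` is the distribution of `G_q(x)` in the vacuum state: a compactly supported probability
measure on `ℝ` with the vacuum moments of `G_q(x)`, and the only probability measure with these
moments. -/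
structure IsVacuumDistribution (q : ℝ) (J : H →L[ℂ] H) (x : H) (μ : Measure ℝ) : Prop where
  isProbabilityMeasure : IsProbabilityMeasure μ
  compactSupport : ∃ R : ℝ, μ (Set.Icc (-R) R)ᶜ = 0
  moments : HasVacuumMoments q J x μ
  unique : ∀ ν : Measure ℝ, IsProbabilityMeasure ν → HasVacuumMoments q J x ν → ν = μ

/-! ### Orthogonal polynomials -/

/-- The `q`-number `[n]_q = 1 + q + ⋯ + q^{n-1}`. -/
def qNumber (q : ℝ) (n : ℕ) : ℝ := ∑ i ∈ Finset.range n, q ^ i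

/-- `P_0 = 1`, `P_1 = t`, `P_2 = t² - 1`, and
`t P_n = P_{n+1} + [n]_q (1 + q^{n-1}) P_{n-1}` for `n ≥ 2`. -/
def polyD (q : ℝ) : ℕ → Polynomial ℝ
  | 0 => 1
  | 1 => Polynomial.X
  | 2 => Polynomial.X ^ 2 - 1
  | n + 3 => Polynomial.X * polyD q (n + 2) -
      Polynomial.C (qNumber q (n + 2) * (1 + q ^ (n + 1))) * polyD q (n + 1)

/-- `P` is the sequence of the monic orthogonal polynomials of `μ`: `μ` has finite moments of all
orders, `P n` is monic of degree `n`, and the `P n` are nonzero and pairwise orthogonal in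
`L²(μ)`. -/
structure IsMonicOrthogonal (μ : Measure ℝ) (P : ℕ → Polynomial ℝ) : Prop where
  integrable : ∀ n : ℕ, Integrable (fun t : ℝ => t ^ n) μ
  monic : ∀ n, (P n).Monic
  natDegree : ∀ n, (P n).natDegree = n
  orthogonal : ∀ m n, m ≠ n → ∫ t, (P m).eval t * (P n).eval t ∂μ = 0
  ne_zero : ∀ n, 0 < ∫ t, (P n).eval t ^ 2 ∂μ

end TypeDFock

end

noncomputable section

namespace TypeDFock

/-! Two signed indices `a`, `b` of different absolute value encode the root e_a + e_b of the root
system D_n, with e_{-k} = -e_k. The group D(n) consists of the signed permutations with an even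
number of sign changes (`mem_typeD_iff`), and ℓ(σ) counts the positive roots that σ makes negative
(`lengthD_eq`).

Positivity. Let ε_α(σ) = ±1 be the sign of the root σ⁻¹α. Then q^{ℓ(σ⁻¹τ)} is the product over the
positive roots α of (1+q)/2 + (1-q)/2 · ε_α(σ) ε_α(τ). For |q| < 1 both coefficients are positive,
so expanding the product gives a positive combination of kernels w_c(σ) w_c(τ), where w_c is the
product of the ε_α over a set c of positive roots. As D(n) acts isometrically, the form becomes a
sum of squares; it is definite because the w_c add up to a multiple of the indicator of the
identity. Hence the symmetrizer P_n on H^{⊗n} is invertible, and d_q(x) is P_n⁻¹ l(x) P_{n+1} in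
degree n+1, with l(x) the free annihilation operator.

Moments. If x̄ = ±x, then D(n) fixes x^{⊗n}, so P_n multiplies it by the Poincaré polynomial D_n(q),
and d_q(x) x^{⊗(n+1)} = (D_{n+1}(q)/D_n(q)) x^{⊗n}. This quotient is 1 for n = 0 and [n+1]_q (1+q^n)
for n ≥ 1 (`poincareD_succ`): the recursion coefficients of the P_n. Therefore P_n(G) Ω = x^{⊗n}
(`aeval_polyD_vacuum`), and the vacuum functional sends P_n to δ_{n,0}. So does integration against
any probability measure with orthogonal polynomials P_n; the P_n form a basis, so the moments agree.

Existence and uniqueness. The coefficients are positive and bounded, so the associated Jacobi matrix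
is a bounded selfadjoint operator on ℓ²(ℕ), whose spectral measure at the first basis vector is the
required measure. A compactly supported measure is determined by its moments (`eq_of_moments`),
which gives both uniqueness statements. -/

/-! ### Roots and inversions -/

/-- The signed index `-a`. -/
def negIdx {n : ℕ} (a : SignedIndex n) : SignedIndex n := (a.1, -a.2)

/-- The value of a signed index at the half sum of the positive roots. -/
def height {n : ℕ} (a : SignedIndex n) : ℤ := (a.2 : ℤ) * ((n : ℤ) - 1 - (a.1 : ℕ))

theorem height_negIdx {n : ℕ} (a : SignedIndex n) : height (negIdx a) = -height a := by
  simp [height, negIdx]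

theorem typeB_negIdx {n : ℕ} (σ : typeB n) (a : SignedIndex n) :
    σ.1 (negIdx a) = negIdx (σ.1 a) := σ.2 a.1 a.2

theorem typeB_fst_ne {n : ℕ} (σ : typeB n) {a b : SignedIndex n} (h : a.1 ≠ b.1) :
    (σ.1 a).1 ≠ (σ.1 b).1 := by
  intro hab
  rcases Int.units_eq_one_or ((σ.1 a).2 * (σ.1 b).2) with h1 | h1
  · have : σ.1 a = σ.1 b := Prod.ext hab (by
      rcases Int.units_eq_one_or (σ.1 a).2 with h2 | h2 <;>
      rcases Int.units_eq_one_or (σ.1 b).2 with h3 | h3 <;> simp_all)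
    exact h (by rw [σ.1.injective this])
  · have : σ.1 a = σ.1 (negIdx b) := by
      rw [typeB_negIdx]
      exact Prod.ext hab (by
        rcases Int.units_eq_one_or (σ.1 a).2 with h2 | h2 <;>
        rcases Int.units_eq_one_or (σ.1 b).2 with h3 | h3 <;> simp_all [negIdx])
    exact h (by rw [σ.1.injective this]; rfl)

theorem height_cases {n : ℕ} (a : SignedIndex n) :
    (a.2 = 1 ∧ height a = (n : ℤ) - 1 - (a.1 : ℕ)) ∨
      (a.2 = -1 ∧ height a = -((n : ℤ) - 1 - (a.1 : ℕ))) := by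
  rcases Int.units_eq_one_or a.2 with h | h
  · left; simp [height, h]
  · right; simp [height, h]

/-- The absolute heights `n - 1 - i` are nonnegative and pairwise distinct, so no root vanishes at
the half sum of the positive roots, and every root has a sign. -/
theorem height_add_ne_zero {n : ℕ} {a b : SignedIndex n} (h : a.1 ≠ b.1) :
    height a + height b ≠ 0 := by
  have h1 := a.1.isLt
  have h2 := b.1.isLt
  have h3 : (a.1 : ℕ) ≠ b.1 := fun h' => h (Fin.ext h')
  rcases height_cases a with ⟨_, ha⟩ | ⟨_, ha⟩ <;> rcases height_cases b with ⟨_, hb⟩ | ⟨_, hb⟩ <;>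
    rw [ha, hb] <;> omega

/-- The pairs of signed indices `(a, b)` that stand for the roots `e_a + e_b`. -/
def roots (n : ℕ) : Finset (SignedIndex n × SignedIndex n) :=
  Finset.univ.filter fun p => p.1.1 ≠ p.2.1

/-- The positive roots `e_i ± e_j` for `i < j`. -/
def posRoots (n : ℕ) : Finset (SignedIndex n × SignedIndex n) :=
  Finset.univ.filter fun p => p.1.1 < p.2.1 ∧ p.1.2 = 1

theorem mem_posRoots {n : ℕ} {p : SignedIndex n × SignedIndex n} :
    p ∈ posRoots n ↔ p.1.1 < p.2.1 ∧ p.1.2 = 1 := by simp [posRoots]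

theorem fst_ne_of_mem_posRoots {n : ℕ} {p : SignedIndex n × SignedIndex n} (h : p ∈ posRoots n) :
    p.1.1 ≠ p.2.1 := (mem_posRoots.1 h).1.ne

/-- The sign of a root. -/
def rootSign {n : ℕ} (a b : SignedIndex n) : ℤ := Int.sign (height a + height b)

theorem rootSign_comm {n : ℕ} (a b : SignedIndex n) : rootSign a b = rootSign b a := by
  rw [rootSign, rootSign, add_comm]

theorem rootSign_negIdx {n : ℕ} (a b : SignedIndex n) :
    rootSign (negIdx a) (negIdx b) = -rootSign a b := by
  rw [rootSign, rootSign, height_negIdx, height_negIdx, ← neg_add, Int.sign_neg]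

theorem rootSign_eq_one_or {n : ℕ} {a b : SignedIndex n} (h : a.1 ≠ b.1) :
    rootSign a b = 1 ∨ rootSign a b = -1 := by
  rcases lt_or_gt_of_ne (height_add_ne_zero h) with h | h
  · right; exact Int.sign_eq_neg_one_of_neg h
  · left; exact Int.sign_eq_one_of_pos h

theorem height_add_pos {n : ℕ} {p : SignedIndex n × SignedIndex n} (h : p ∈ posRoots n) :
    0 < height p.1 + height p.2 := by
  obtain ⟨h1, h2⟩ := mem_posRoots.1 h
  have h1' : (p.1.1 : ℕ) < p.2.1 := h1
  have := p.2.1.isLt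
  rcases height_cases p.1 with ⟨_, ha⟩ | ⟨h3, _⟩
  · rcases height_cases p.2 with ⟨_, hb⟩ | ⟨_, hb⟩ <;> rw [ha, hb] <;> omega
  · rw [h2] at h3; exact absurd h3 (by decide)

theorem rootSign_of_mem {n : ℕ} {p : SignedIndex n × SignedIndex n} (h : p ∈ posRoots n) :
    rootSign p.1 p.2 = 1 := Int.sign_eq_one_of_pos (height_add_pos h)

/-- Among `(a, b)`, `(b, a)`, `(-a, -b)`, `(-b, -a)` exactly one lies in `posRoots`. This trades
sums over the positive roots for sums over all roots, which every signed permutation merely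
permutes. -/
theorem sum_roots {n : ℕ} (f : SignedIndex n × SignedIndex n → ℕ)
    (hswap : ∀ p, f p.swap = f p) (hneg : ∀ p, f (negIdx p.1, negIdx p.2) = f p) :
    ∑ p ∈ roots n, f p = 4 * ∑ p ∈ posRoots n, f p := by
  have h1 : ∑ p ∈ roots n, f p =
      ∑ p with p.1.1 < p.2.1, f p + ∑ p with p.2.1 < p.1.1, f p := by
    rw [← Finset.sum_filter_add_sum_filter_not (roots n) (fun p => p.1.1 < p.2.1)]
    congr 1
    · refine Finset.sum_congr ?_ fun _ _ => rfl
      ext p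
      simp only [roots, Finset.mem_filter, Finset.mem_univ, true_and]
      exact ⟨fun h => h.2, fun h => ⟨h.ne, h⟩⟩
    · refine Finset.sum_congr ?_ fun _ _ => rfl
      ext p
      simp only [roots, Finset.mem_filter, Finset.mem_univ, true_and, not_lt]
      exact ⟨fun h => lt_of_le_of_ne h.2 (Ne.symm h.1), fun h => ⟨h.ne', h.le⟩⟩
  have h2 : ∑ p : SignedIndex n × SignedIndex n with p.2.1 < p.1.1, f p =
      ∑ p : SignedIndex n × SignedIndex n with p.1.1 < p.2.1, f p :=
    Finset.sum_nbij' Prod.swap Prod.swap (by simp) (by simp) (by simp) (by simp)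
      (fun p _ => (hswap p).symm)
  have h3 : ∑ p : SignedIndex n × SignedIndex n with p.1.1 < p.2.1, f p =
      ∑ p ∈ posRoots n, f p + ∑ p with p.1.1 < p.2.1 ∧ p.1.2 ≠ 1, f p := by
    rw [← Finset.sum_filter_add_sum_filter_not _ (fun p => p.1.2 = 1), Finset.filter_filter,
      Finset.filter_filter]
    rfl
  have h4 : ∑ p : SignedIndex n × SignedIndex n with p.1.1 < p.2.1 ∧ p.1.2 ≠ 1, f p =
      ∑ p ∈ posRoots n, f p := by
    refine Finset.sum_nbij' (fun p => (negIdx p.1, negIdx p.2)) (fun p => (negIdx p.1, negIdx p.2))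
      ?_ ?_ (by simp [negIdx]) (by simp [negIdx]) (fun p _ => (hneg p).symm)
    · intro p hp
      simp only [Finset.mem_filter, Finset.mem_univ, true_and] at hp
      refine mem_posRoots.2 ⟨hp.1, ?_⟩
      rcases Int.units_eq_one_or p.1.2 with h | h
      · exact absurd h hp.2
      · simp [negIdx, h]
    · intro p hp
      obtain ⟨h, h'⟩ := mem_posRoots.1 hp
      simp only [Finset.mem_filter, Finset.mem_univ, true_and]
      refine ⟨h, ?_⟩
      simp only [negIdx, h']
      decide
  rw [h1, h2, h3, h4]
  ring

/-- The number of positive roots to which `σ` and `τ` give different signs. -/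
def signDist {n : ℕ} (σ τ : typeB n) : ℕ :=
  ∑ p ∈ posRoots n, if rootSign (σ.1 p.1) (σ.1 p.2) = rootSign (τ.1 p.1) (τ.1 p.2) then 0 else 1

theorem four_mul_signDist {n : ℕ} (σ τ : typeB n) :
    4 * signDist σ τ = ∑ p ∈ roots n,
      if rootSign (σ.1 p.1) (σ.1 p.2) = rootSign (τ.1 p.1) (τ.1 p.2) then 0 else 1 := by
  rw [sum_roots, signDist]
  · intro p
    simp only [Prod.fst_swap, Prod.snd_swap]
    simp only [rootSign_comm (σ.1 p.2), rootSign_comm (τ.1 p.2)]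
  · intro p
    simp only [typeB_negIdx, rootSign_negIdx, neg_inj]

/-- `ρ` permutes the set of all roots, so it only reindexes the sum of `four_mul_signDist`. -/
theorem signDist_mul_right {n : ℕ} (σ τ ρ : typeB n) :
    signDist (σ * ρ) (τ * ρ) = signDist σ τ := by
  have h : 4 * signDist (σ * ρ) (τ * ρ) = 4 * signDist σ τ := by
    rw [four_mul_signDist, four_mul_signDist]
    refine Finset.sum_nbij' (fun p => (ρ.1 p.1, ρ.1 p.2)) (fun p => (ρ⁻¹.1 p.1, ρ⁻¹.1 p.2))
      ?_ ?_ (by simp) (by simp) (fun _ _ => rfl)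
    · intro p hp
      simp only [roots, Finset.mem_filter, Finset.mem_univ, true_and] at hp ⊢
      exact typeB_fst_ne ρ hp
    · intro p hp
      simp only [roots, Finset.mem_filter, Finset.mem_univ, true_and] at hp ⊢
      exact typeB_fst_ne ρ⁻¹ hp
  omega

theorem signDist_triangle {n : ℕ} (σ τ ρ : typeB n) :
    signDist σ ρ ≤ signDist σ τ + signDist τ ρ := by
  rw [signDist, signDist, signDist, ← Finset.sum_add_distrib]
  refine Finset.sum_le_sum fun p _ => ?_
  split_ifs <;> simp_all

/-- The number of positive roots that `σ` makes negative. -/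
def inversions {n : ℕ} (σ : typeB n) : ℕ := signDist 1 σ

theorem inversions_one {n : ℕ} : inversions (1 : typeB n) = 0 := by simp [inversions, signDist]

theorem inversions_inv_mul {n : ℕ} (σ τ : typeB n) :
    inversions (σ⁻¹ * τ) = signDist τ⁻¹ σ⁻¹ := by
  rw [inversions, ← signDist_mul_right _ _ τ⁻¹]
  simp

theorem inversions_mul_le {n : ℕ} (σ τ : typeB n) :
    inversions (σ * τ) ≤ inversions σ + inversions τ := by
  have h := signDist_triangle 1 τ (σ * τ)
  have h2 := signDist_mul_right 1 σ τ
  rw [one_mul] at h2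
  simp only [inversions]
  omega

/-! ### Simple reflections and their effect on inversions -/

/-- `s` is the reflection of the simple root `e_a + e_b`. -/
structure IsSimpleReflection {n : ℕ} (s : typeB n) (a b : SignedIndex n) : Prop where
  mul_self : s * s = 1
  mem : (a, b) ∈ posRoots n
  height_add : height a + height b = 1
  height_left : height (s.1 a) = height a - 1
  height_right : height (s.1 b) = height b - 1
  height_le : ∀ c, c ≠ a → c ≠ b → height c ≤ height (s.1 c)

theorem IsSimpleReflection.rootSign_self {n : ℕ} {s : typeB n} {a b : SignedIndex n}
    (h : IsSimpleReflection s a b) : rootSign (s.1 a) (s.1 b) = -1 := by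
  refine Int.sign_eq_neg_one_of_neg ?_
  have := h.height_add
  rw [h.height_left, h.height_right]
  omega

/-- Only `a` and `b` lose height, by 1 each. A positive root other than `(a, b)` involves at most
one of them, so its height, an integer at least 1, stays nonnegative; being nonzero, it stays
positive. -/
theorem IsSimpleReflection.rootSign_of_ne {n : ℕ} {s : typeB n} {a b : SignedIndex n}
    (h : IsSimpleReflection s a b) {p : SignedIndex n × SignedIndex n} (hp : p ∈ posRoots n)
    (hne : p ≠ (a, b)) : rootSign (s.1 p.1) (s.1 p.2) = 1 := by
  have h1 := height_add_pos hp
  have h2 := height_add_ne_zero (typeB_fst_ne s (fst_ne_of_mem_posRoots hp))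
  have hab := (mem_posRoots.1 h.mem).1
  have hp1 := (mem_posRoots.1 hp).1
  have key : ∀ c, height c - 1 ≤ height (s.1 c) := by
    intro c
    by_cases hca : c = a
    · rw [hca, h.height_left]
    by_cases hcb : c = b
    · rw [hcb, h.height_right]
    linarith [h.height_le c hca hcb]
  refine Int.sign_eq_one_of_pos ?_
  have k1 := key p.1
  have k2 := key p.2
  by_cases c1 : p.1 ≠ a ∧ p.1 ≠ b
  · have := h.height_le p.1 c1.1 c1.2
    omega
  by_cases c2 : p.2 ≠ a ∧ p.2 ≠ b
  · have := h.height_le p.2 c2.1 c2.2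
    omega
  exfalso
  rw [not_and_or, not_not, not_not] at c1 c2
  rcases c1 with c1 | c1 <;> rcases c2 with c2 | c2
  · rw [c1, c2] at hp1; exact lt_irrefl _ hp1
  · exact hne (Prod.ext c1 c2)
  · rw [c1, c2] at hp1; exact lt_asymm hab hp1
  · rw [c1, c2] at hp1; exact lt_irrefl _ hp1

theorem IsSimpleReflection.inversions_eq_one {n : ℕ} {s : typeB n} {a b : SignedIndex n}
    (h : IsSimpleReflection s a b) : inversions s = 1 := by
  rw [inversions, signDist, Finset.sum_eq_single_of_mem _ h.mem]
  · have h1 := rootSign_of_mem h.mem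
    dsimp only at h1 ⊢
    rw [h.rootSign_self]
    simp [h1]
  · intro p hp hne
    rw [h.rootSign_of_ne hp hne]
    simp [rootSign_of_mem hp]

/-- By right invariance the inversions of `σ * s` measure the distance from `s` to `σ`. On positive
roots `s` has the same signs as the identity except at `(a, b)`, where it agrees with `σ` and the
identity does not. -/
theorem IsSimpleReflection.inversions_mul {n : ℕ} {s : typeB n} {a b : SignedIndex n}
    (h : IsSimpleReflection s a b) (σ : typeB n) (hσ : rootSign (σ.1 a) (σ.1 b) = -1) :
    inversions (σ * s) + 1 = inversions σ := by
  have h1 : inversions (σ * s) = signDist s σ := by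
    rw [inversions, ← signDist_mul_right _ _ s, mul_assoc, h.mul_self]
    simp
  rw [h1, inversions, signDist, signDist, ← Finset.add_sum_erase _ _ h.mem,
    ← Finset.add_sum_erase _ _ h.mem]
  have h2 := rootSign_of_mem h.mem
  dsimp only at h2 ⊢
  rw [h.rootSign_self, hσ]
  have h3 : ∀ p ∈ (posRoots n).erase (a, b),
      (if rootSign (s.1 p.1) (s.1 p.2) = rootSign (σ.1 p.1) (σ.1 p.2) then 0 else 1) =
      (if rootSign ((1 : typeB n).1 p.1) ((1 : typeB n).1 p.2) =
        rootSign (σ.1 p.1) (σ.1 p.2) then 0 else 1) := by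
    intro p hp
    rw [h.rootSign_of_ne (Finset.mem_of_mem_erase hp) (Finset.ne_of_mem_erase hp)]
    simp [rootSign_of_mem (Finset.mem_of_mem_erase hp)]
  rw [Finset.sum_congr rfl h3]
  simp [h2, add_comm]

/-! ### The length function of `D(n)` -/

theorem swapB_apply {n : ℕ} (i j : Fin n) (a : SignedIndex n) :
    (swapB i j).1 a = (Equiv.swap i j a.1, a.2) := rfl

theorem flipB_apply {n : ℕ} (i : Fin n) (a : SignedIndex n) :
    (flipB i).1 a = (a.1, if a.1 = i then -a.2 else a.2) := rfl

theorem typeB_mul_apply {n : ℕ} (σ τ : typeB n) (a : SignedIndex n) :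
    (σ * τ).1 a = σ.1 (τ.1 a) := rfl

theorem typeB_ext {n : ℕ} {σ τ : typeB n} (h : ∀ a, σ.1 a = τ.1 a) : σ = τ :=
  Subtype.ext (Equiv.ext h)

theorem isSimpleReflection_swapB {n i : ℕ} (h : i + 1 < n) :
    IsSimpleReflection (swapB (⟨i, by omega⟩ : Fin n) ⟨i + 1, h⟩) (⟨i, by omega⟩, 1)
      (⟨i + 1, h⟩, -1) where
  mul_self := typeB_ext fun a => by simp [swapB_apply]
  mem := by simp [mem_posRoots]
  height_add := by simp [height]
  height_left := by simp [swapB_apply, height]; ring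
  height_right := by simp [swapB_apply, height]; ring
  height_le := by
    rintro ⟨k, s⟩ ha hb
    rw [swapB_apply]
    dsimp only
    by_cases h1 : k = ⟨i, by omega⟩
    · subst h1
      rcases Int.units_eq_one_or s with rfl | rfl
      · exact absurd rfl ha
      · simp [height]
    by_cases h2 : k = ⟨i + 1, h⟩
    · subst h2
      rcases Int.units_eq_one_or s with rfl | rfl
      · simp [height]; omega
      · exact absurd rfl hb
    rw [Equiv.swap_apply_of_ne_of_ne h1 h2]

/-- The simple root is e_{n-1} + e_n; its height is 1 because the last index has height 0. -/
theorem isSimpleReflection_flip_swap_flip (i : ℕ) :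
    IsSimpleReflection (flipB (⟨i + 1, by omega⟩ : Fin (i + 2)) *
      swapB ⟨i, by omega⟩ ⟨i + 1, by omega⟩ * flipB ⟨i + 1, by omega⟩) (⟨i, by omega⟩, 1)
      (⟨i + 1, by omega⟩, 1) where
  mul_self := by
    have h1 : flipB (⟨i + 1, by omega⟩ : Fin (i + 2)) * flipB ⟨i + 1, by omega⟩ = 1 :=
      typeB_ext fun a => by
        rw [typeB_mul_apply, flipB_apply, flipB_apply]
        by_cases h : a.1 = ⟨i + 1, by omega⟩ <;> simp [h]
        ext <;> simp [h]
    have h2 := (isSimpleReflection_swapB (n := i + 2) (i := i) (by omega)).mul_self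
    generalize flipB (⟨i + 1, by omega⟩ : Fin (i + 2)) = f at *
    calc _ = f * swapB ⟨i, by omega⟩ ⟨i + 1, by omega⟩ * (f * f) *
          swapB ⟨i, by omega⟩ ⟨i + 1, by omega⟩ * f := by simp only [mul_assoc]
      _ = f * (swapB ⟨i, by omega⟩ ⟨i + 1, by omega⟩ *
          swapB ⟨i, by omega⟩ ⟨i + 1, by omega⟩) * f := by rw [h1]; simp only [mul_assoc, one_mul]
      _ = 1 := by rw [h2, mul_one, h1]
  mem := by simp [mem_posRoots]
  height_add := by simp [height]; ring
  height_left := by simp [flipB_apply, swapB_apply, height]; ring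
  height_right := by simp [flipB_apply, swapB_apply, height]; ring
  height_le := by
    rintro ⟨k, s⟩ ha hb
    rw [typeB_mul_apply, typeB_mul_apply, flipB_apply, swapB_apply, flipB_apply]
    dsimp only
    by_cases h1 : k = ⟨i, by omega⟩
    · subst h1
      rcases Int.units_eq_one_or s with rfl | rfl
      · exact absurd rfl ha
      · simp [height]; omega
    by_cases h2 : k = ⟨i + 1, by omega⟩
    · subst h2
      rcases Int.units_eq_one_or s with rfl | rfl
      · exact absurd rfl hb
      · simp [height]; omega
    rw [Equiv.swap_apply_of_ne_of_ne h1 h2]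
    simp [h2]

theorem exists_isSimpleReflection {n : ℕ} {s : typeB n} (hs : s ∈ genD n) :
    ∃ a b, IsSimpleReflection s a b := by
  rcases hs with ⟨i, h, rfl⟩ | ⟨i, rfl, rfl⟩
  · exact ⟨_, _, isSimpleReflection_swapB h⟩
  · exact ⟨_, _, isSimpleReflection_flip_swap_flip i⟩

/-! ### Even signed permutations and reduced words -/

/-- The parity of the number of sign changes of a signed permutation. -/
def signParity {n : ℕ} (σ : typeB n) : ℤˣ := ∏ k, (σ.1 (k, 1)).2

theorem snd_apply {n : ℕ} (σ : typeB n) (a : SignedIndex n) :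
    (σ.1 a).2 = (σ.1 (a.1, 1)).2 * a.2 := by
  rcases Int.units_eq_one_or a.2 with h | h
  · have : a = (a.1, 1) := Prod.ext rfl h
    rw [h, mul_one, ← this]
  · have : a = negIdx (a.1, 1) := Prod.ext rfl h
    rw [h, this, typeB_negIdx]
    simp [negIdx]

theorem fst_apply {n : ℕ} (σ : typeB n) (a : SignedIndex n) :
    (σ.1 a).1 = absPerm σ a.1 := by
  rcases Int.units_eq_one_or a.2 with h | h
  · have : a = (a.1, 1) := Prod.ext rfl h
    rw [this]; rfl
  · have : a = negIdx (a.1, 1) := Prod.ext rfl h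
    rw [this, typeB_negIdx]
    rfl

theorem signParity_mul {n : ℕ} (σ τ : typeB n) :
    signParity (σ * τ) = signParity σ * signParity τ := by
  have h : ∀ k, ((σ * τ).1 (k, 1)).2 = (σ.1 (absPerm τ k, 1)).2 * (τ.1 (k, 1)).2 := by
    intro k
    rw [typeB_mul_apply, snd_apply, fst_apply]
  rw [signParity, Finset.prod_congr rfl fun k _ => h k, Finset.prod_mul_distrib,
    Equiv.prod_comp (absPerm τ) fun k => (σ.1 (k, 1)).2]
  rfl

theorem signParity_swapB {n : ℕ} (i j : Fin n) : signParity (swapB i j) = 1 := by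
  simp [signParity, swapB_apply]

theorem signParity_flipB {n : ℕ} (i : Fin n) : signParity (flipB i) = -1 := by
  simp [signParity, flipB_apply, Finset.prod_ite_eq']

theorem signParity_genD {n : ℕ} {s : typeB n} (hs : s ∈ genD n) : signParity s = 1 := by
  rcases hs with ⟨i, h, rfl⟩ | ⟨i, rfl, rfl⟩
  · exact signParity_swapB _ _
  · rw [signParity_mul, signParity_mul, signParity_swapB, signParity_flipB]
    rfl

/-- Positivity at the roots e_i - e_{i+1} makes the heights of the images of 1, …, n strictly
decreasing. Positivity at e_{n-1} + e_n then makes all but the last of them positive, so only the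
last index could change sign, which the parity forbids. What remains is an increasing permutation,
hence the identity. -/
theorem eq_one_of_rootSign {n : ℕ} {σ : typeB n} (hpar : signParity σ = 1)
    (h : ∀ s ∈ genD n, ∀ a b, IsSimpleReflection s a b → rootSign (σ.1 a) (σ.1 b) = 1) :
    σ = 1 := by
  have hdec : ∀ (i : ℕ) (hi : i + 1 < n),
      height (σ.1 (⟨i + 1, hi⟩, 1)) < height (σ.1 (⟨i, by omega⟩, 1)) := by
    intro i hi
    have := h _ (Or.inl ⟨i, hi, rfl⟩) _ _ (isSimpleReflection_swapB hi)
    have := Int.pos_of_sign_eq_one this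
    have h2 : σ.1 (⟨i + 1, hi⟩, -1) = negIdx (σ.1 (⟨i + 1, hi⟩, 1)) := typeB_negIdx σ (_, 1)
    rw [h2, height_negIdx] at this
    linarith
  have hlast : ∀ (i : ℕ) (hi : i + 2 = n),
      0 < height (σ.1 (⟨i, by omega⟩, 1)) + height (σ.1 (⟨i + 1, by omega⟩, 1)) := by
    rintro i rfl
    exact Int.pos_of_sign_eq_one
      (h _ (Or.inr ⟨i, rfl, rfl⟩) _ _ (isSimpleReflection_flip_swap_flip i))
  -- Here `d` is the distance to the next-to-last index. At `d = 0`, the larger of two numbers with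
  -- positive sum is positive.
  have hpos : ∀ (d i : ℕ) (hi : i + 2 + d = n), 0 < height (σ.1 (⟨i, by omega⟩, 1)) := by
    intro d
    induction d with
    | zero =>
      intro i hi
      have h1 := hlast i hi
      have h2 := hdec i (by omega)
      linarith
    | succ d ih =>
      intro i hi
      exact (ih (i + 1) (by omega)).trans (hdec i (by omega))
  have hone : ∀ k : Fin n, (k : ℕ) + 1 < n → (σ.1 (k, 1)).2 = 1 := by
    intro k hk
    have h1 := hpos (n - 2 - k) k (by omega)
    rcases height_cases (σ.1 (k, 1)) with ⟨h2, _⟩ | ⟨_, h2⟩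
    · exact h2
    · rw [h2] at h1
      have := (σ.1 (k, 1)).1.isLt
      omega
  have hall : ∀ k : Fin n, (σ.1 (k, 1)).2 = 1 := by
    intro k
    by_cases hk : (k : ℕ) + 1 < n
    · exact hone k hk
    rw [signParity, Finset.prod_eq_single k] at hpar
    · exact hpar
    · intro j _ hj
      refine hone j ?_
      have : (j : ℕ) ≠ k := fun h' => hj (Fin.ext h')
      omega
    · simp
  have hmono : StrictMono (absPerm σ) := by
    cases n with
    | zero => exact fun a => a.elim0
    | succ m =>
      refine Fin.strictMono_iff_lt_succ.2 fun i => ?_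
      have h1 := hdec i (by omega)
      simp only [height, hall] at h1
      have h2 : (((σ.1 (i.castSucc, 1)).1 : ℕ) : ℤ) < ((σ.1 (i.succ, 1)).1 : ℕ) := by
        have e1 : (⟨i, by omega⟩ : Fin (m + 1)) = i.castSucc := rfl
        have e2 : (⟨i + 1, by omega⟩ : Fin (m + 1)) = i.succ := rfl
        rw [e1, e2] at h1
        push_cast at h1
        linarith
      exact_mod_cast h2
  have hid : ∀ k, absPerm σ k = k := by
    intro k
    have : (hmono.orderIsoOfSurjective _ (absPerm σ).surjective) = OrderIso.refl (Fin n) :=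
      Subsingleton.elim _ _
    exact congrArg (fun e : Fin n ≃o Fin n => e k) this
  refine typeB_ext fun a => Prod.ext ?_ ?_
  · rw [fst_apply, hid]; rfl
  · rw [snd_apply, hall, one_mul]; rfl

theorem inversions_prod_le {n : ℕ} (w : List (typeB n)) (hw : ∀ g ∈ w, g ∈ genD n) :
    inversions w.prod ≤ w.length := by
  induction w with
  | nil => simp [inversions_one]
  | cons g w ih =>
    have h1 := ih fun x hx => hw x (List.mem_cons_of_mem _ hx)
    obtain ⟨a, b, hab⟩ := exists_isSimpleReflection (hw g List.mem_cons_self)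
    have h2 := inversions_mul_le g w.prod
    rw [hab.inversions_eq_one] at h2
    rw [List.prod_cons, List.length_cons]
    omega

/-- While some simple root is made negative, multiplying by its reflection removes one inversion;
when none is left, the element is trivial. Only parity is assumed, so this proves both that even
signed permutations are products of the generators and that their length is at most the number of
inversions. -/
theorem exists_reduced_word {n : ℕ} (N : ℕ) (σ : typeB n) (hpar : signParity σ = 1)
    (hN : inversions σ = N) :
    ∃ w : List (typeB n), w.length = N ∧ (∀ g ∈ w, g ∈ genD n) ∧ w.prod = σ := by
  induction N generalizing σ with
  | zero =>
    refine ⟨[], rfl, by simp, ?_⟩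
    rw [List.prod_nil, eq_one_of_rootSign hpar]
    intro s _ a b hab
    rcases rootSign_eq_one_or (typeB_fst_ne σ (fst_ne_of_mem_posRoots hab.mem)) with h | h
    · exact h
    · have := hab.inversions_mul σ h
      omega
  | succ N ih =>
    by_cases h : ∃ s ∈ genD n, ∃ a b, IsSimpleReflection s a b ∧ rootSign (σ.1 a) (σ.1 b) = -1
    · obtain ⟨s, hs, a, b, hab, hneg⟩ := h
      have h1 := hab.inversions_mul σ hneg
      obtain ⟨w, hw1, hw2, hw3⟩ := ih (σ * s)
        (by rw [signParity_mul, hpar, signParity_genD hs, one_mul]) (by omega)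
      refine ⟨w ++ [s], by simp [hw1], ?_, ?_⟩
      · intro g hg
        rcases List.mem_append.1 hg with hg | hg
        · exact hw2 g hg
        · rw [List.mem_singleton.1 hg]; exact hs
      · rw [List.prod_append, hw3, List.prod_singleton, mul_assoc, hab.mul_self, mul_one]
    · exfalso
      have : σ = 1 := eq_one_of_rootSign hpar fun s hs a b hab =>
        (rootSign_eq_one_or (typeB_fst_ne σ (fst_ne_of_mem_posRoots hab.mem))).resolve_right
          fun hneg => h ⟨s, hs, a, b, hab, hneg⟩
      rw [this, inversions_one] at hN
      omega

theorem mem_typeD_iff {n : ℕ} (σ : typeB n) : σ ∈ typeD n ↔ signParity σ = 1 := by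
  constructor
  · intro h
    induction h using Subgroup.closure_induction with
    | mem s hs => exact signParity_genD hs
    | one => simp [signParity]
    | mul a b _ _ ha hb => rw [signParity_mul, ha, hb, one_mul]
    | inv a _ ha =>
      have : signParity (a⁻¹ * a) = 1 := by rw [inv_mul_cancel]; simp [signParity]
      rw [signParity_mul, ha, mul_one] at this
      exact this
  · intro h
    obtain ⟨w, _, hw, rfl⟩ := exists_reduced_word _ σ h rfl
    exact Subgroup.list_prod_mem _ fun g hg => Subgroup.subset_closure (hw g hg)

theorem lengthD_eq {n : ℕ} (σ : typeD n) : lengthD σ = inversions (σ : typeB n) := by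
  obtain ⟨w, hw⟩ := exists_reduced_word _ _ ((mem_typeD_iff _).1 σ.2) rfl
  refine le_antisymm (Nat.sInf_le ⟨w, hw⟩) ?_
  refine le_csInf ⟨_, w, hw⟩ ?_
  rintro k ⟨v, rfl, hv, hv'⟩
  rw [← hv']
  exact inversions_prod_le v hv

theorem eq_of_signDist_eq_zero {n : ℕ} {σ τ : typeB n} (hσ : σ ∈ typeD n) (hτ : τ ∈ typeD n)
    (h : signDist σ⁻¹ τ⁻¹ = 0) : σ = τ := by
  rw [← inversions_inv_mul] at h
  obtain ⟨w, hw, _, hw'⟩ := exists_reduced_word 0 (τ⁻¹ * σ)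
    ((mem_typeD_iff _).1 (mul_mem (inv_mem hτ) hσ)) h
  rw [List.length_eq_zero_iff.1 hw, List.prod_nil] at hw'
  exact (inv_mul_eq_one.1 hw'.symm).symm

/-! ### The Poincaré polynomial of `D(n)` -/

/-- The signed permutation `k ↦ ε k · π k`. -/
def signedPerm {n : ℕ} (π : Equiv.Perm (Fin n)) (ε : Fin n → ℤˣ) : typeB n :=
  ⟨{ toFun := fun a => (π a.1, ε a.1 * a.2)
     invFun := fun a => (π.symm a.1, ε (π.symm a.1) * a.2)
     left_inv := fun a => by simp [← mul_assoc]
     right_inv := fun a => by simp [← mul_assoc] },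
   fun k s => by simp⟩

theorem signedPerm_apply {n : ℕ} (π : Equiv.Perm (Fin n)) (ε : Fin n → ℤˣ) (a : SignedIndex n) :
    (signedPerm π ε).1 a = (π a.1, ε a.1 * a.2) := rfl

/-- Signed permutations as pairs of a permutation and a choice of signs. -/
def typeBEquiv (n : ℕ) : Equiv.Perm (Fin n) × (Fin n → ℤˣ) ≃ typeB n where
  toFun x := signedPerm x.1 x.2
  invFun σ := (absPerm σ, fun k => (σ.1 (k, 1)).2)
  left_inv x := by
    refine Prod.ext (Equiv.ext fun k => rfl) (funext fun k => ?_)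
    simp [signedPerm_apply]
  right_inv σ := typeB_ext fun a => by
    rw [signedPerm_apply]
    exact Prod.ext (fst_apply σ a).symm (snd_apply σ a).symm

instance (n : ℕ) : Fintype (typeB n) := Fintype.ofEquiv _ (typeBEquiv n)

theorem sum_posRoots {n : ℕ} (f : SignedIndex n × SignedIndex n → ℕ) :
    ∑ p ∈ posRoots n, f p =
      ∑ i, ∑ j, if i < j then f ((i, 1), (j, 1)) + f ((i, 1), (j, -1)) else 0 := by
  have hu : ∀ g : ℤˣ → ℕ, ∑ s, g s = g 1 + g (-1) := by
    intro g
    rw [show (Finset.univ : Finset ℤˣ) = {1, -1} from by decide, Finset.sum_pair (by decide)]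
  rw [posRoots, Finset.sum_filter, Fintype.sum_prod_type, Fintype.sum_prod_type]
  refine Finset.sum_congr rfl fun i _ => ?_
  rw [hu]
  have h1 : ¬ (-1 : ℤˣ) = 1 := by decide
  simp only [Fintype.sum_prod_type, hu, and_true, h1, and_false, if_false, add_zero,
    Finset.sum_const_zero]
  refine Finset.sum_congr rfl fun j _ => ?_
  split_ifs <;> rfl

/-- The number of sign changes of the roots `e_i ± e_j`, `i < j`, under a signed permutation with
`|σ i| = a`, `|σ j| = b` and `σ i` of sign `e`. -/
def pairInversions {n : ℕ} (e : ℤˣ) (a b : Fin n) : ℕ :=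
  if a < b then (if e = 1 then 0 else 2) else 1

/-- The index of larger absolute height decides the sign of e_a ± e_b. If it is `a`, both roots have
the sign of `a`; if it is `b`, exactly one of them is negative. The sign of `b` never matters. -/
theorem rootSign_pair {n : ℕ} {a b : SignedIndex n} (h : a.1 ≠ b.1) :
    ((if (1 : ℤ) = rootSign a b then 0 else 1) + (if (1 : ℤ) = rootSign a (negIdx b) then 0 else 1))
      = pairInversions a.2 a.1 b.1 := by
  have h3 : (a.1 : ℕ) ≠ b.1 := fun h' => h (Fin.ext h')
  have ha := a.1.isLt
  have hb := b.1.isLt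
  have key : ∀ z : ℤ, (1 : ℤ) = Int.sign z ↔ 0 < z := fun z =>
    ⟨fun h => Int.pos_of_sign_eq_one h.symm, fun h => (Int.sign_eq_one_of_pos h).symm⟩
  simp only [rootSign, height_negIdx, pairInversions, key, Fin.lt_def]
  have hn : ¬ (-1 : ℤˣ) = 1 := by decide
  rcases height_cases a with ⟨ea, va⟩ | ⟨ea, va⟩ <;> rcases height_cases b with ⟨_, vb⟩ | ⟨_, vb⟩ <;>
    rw [va, vb, ea] <;> simp only [hn, if_true, if_false] <;> split_ifs <;> omega

theorem inversions_signedPerm {n : ℕ} (π : Equiv.Perm (Fin n)) (ε : Fin n → ℤˣ) :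
    inversions (signedPerm π ε) =
      ∑ i, ∑ j, if i < j then pairInversions (ε i) (π i) (π j) else 0 := by
  rw [inversions, signDist, sum_posRoots]
  refine Finset.sum_congr rfl fun i _ => Finset.sum_congr rfl fun j _ => ?_
  by_cases hij : i < j
  · rw [if_pos hij, if_pos hij]
    have m1 : (((i, 1), (j, 1)) : SignedIndex n × SignedIndex n) ∈ posRoots n :=
      mem_posRoots.2 ⟨hij, rfl⟩
    have m2 : (((i, 1), (j, -1)) : SignedIndex n × SignedIndex n) ∈ posRoots n :=
      mem_posRoots.2 ⟨hij, rfl⟩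
    have h1 := rootSign_of_mem m1
    have h2 := rootSign_of_mem m2
    have h3 := rootSign_pair (a := (π i, ε i)) (b := (π j, ε j))
      (fun h => hij.ne (π.injective h))
    dsimp only at h1 h2 h3
    rw [← h3]
    simp only [Subgroup.coe_one, Equiv.Perm.one_apply, h1, h2, signedPerm_apply, mul_one, negIdx,
      mul_neg]
    rfl
  · rw [if_neg hij, if_neg hij]

/-- The permutation of `Fin (n + 1)` that sends `0` to `p` and acts as `τ` on the other indices. -/
def insertPerm {n : ℕ} (x : Fin (n + 1) × Equiv.Perm (Fin n)) : Equiv.Perm (Fin (n + 1)) :=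
  x.1.cycleRange.symm * Equiv.Perm.decomposeFin.symm (0, x.2)

theorem insertPerm_zero {n : ℕ} (x : Fin (n + 1) × Equiv.Perm (Fin n)) :
    insertPerm x 0 = x.1 := by
  simp [insertPerm, Fin.cycleRange_symm_zero]

theorem insertPerm_succ {n : ℕ} (x : Fin (n + 1) × Equiv.Perm (Fin n)) (j : Fin n) :
    insertPerm x j.succ = x.1.succAbove (x.2 j) := by
  simp [insertPerm, Fin.cycleRange_symm_succ]

theorem insertPerm_bijective (n : ℕ) : Function.Bijective (insertPerm (n := n)) := by
  rw [Fintype.bijective_iff_injective_and_card]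
  constructor
  · intro x y h
    have h0 : x.1 = y.1 := by rw [← insertPerm_zero, h, insertPerm_zero]
    refine Prod.ext h0 (Equiv.ext fun j => ?_)
    have h1 := insertPerm_succ x j
    rw [h, insertPerm_succ, h0] at h1
    exact (Fin.succAbove_right_injective h1).symm
  · simp [Fintype.card_perm, Nat.factorial_succ]

/-- Among the pairs containing the first index, the `p` images below `p` contribute 1 each, and the
`n - p` images above contribute 0 or 2 each, giving `p` or `p + 2(n - p)`. The other pairs are
unaffected since `Fin.succAbove` preserves order. -/
theorem inversions_insertPerm {n : ℕ} (p : Fin (n + 1)) (τ : Equiv.Perm (Fin n)) (e : ℤˣ)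
    (ε : Fin n → ℤˣ) :
    inversions (signedPerm (insertPerm (p, τ)) (Fin.cons e ε)) =
      (if e = 1 then (p : ℕ) else 2 * n - p) + inversions (signedPerm τ ε) := by
  rw [inversions_signedPerm, inversions_signedPerm, Fin.sum_univ_succ]
  congr 1
  · rw [Fin.sum_univ_succ]
    simp only [lt_irrefl, if_false, Fin.succ_pos, if_true, zero_add, Fin.cons_zero,
      insertPerm_zero, insertPerm_succ]
    rw [Equiv.sum_comp τ fun k => pairInversions e p (p.succAbove k)]
    have h : ∀ k : Fin n, pairInversions e p (p.succAbove k) =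
        if (k : ℕ) < p then 1 else (if e = 1 then 0 else 2) := by
      intro k
      simp only [pairInversions, Fin.lt_succAbove_iff_le_castSucc, Fin.le_def, Fin.val_castSucc]
      split_ifs <;> first | rfl | omega
    rw [Finset.sum_congr rfl fun k _ => h k, Finset.sum_ite, Finset.sum_const, Finset.sum_const]
    have hp := p.isLt
    have c1 : (Finset.univ.filter fun k : Fin n => (k : ℕ) < p).card = p := by
      rw [Fin.card_filter_val_lt]; omega
    have c2 : (Finset.univ.filter fun k : Fin n => ¬ (k : ℕ) < p).card = n - p := by
      have := Finset.card_filter_add_card_filter_not (s := (Finset.univ : Finset (Fin n)))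
        (fun k : Fin n => (k : ℕ) < p)
      rw [c1, Finset.card_univ, Fintype.card_fin] at this
      omega
    rw [c1, c2]
    split_ifs
    · simp
    · rw [smul_eq_mul, smul_eq_mul]; omega
  · refine Finset.sum_congr rfl fun i _ => ?_
    rw [Fin.sum_univ_succ]
    simp only [Fin.not_lt_zero, if_false, zero_add, Fin.succ_lt_succ_iff, Fin.cons_succ,
      insertPerm_succ, pairInversions, Fin.succAbove_lt_succAbove_iff]

theorem sum_insertPerm (q : ℝ) (n : ℕ) :
    ∑ p : Fin (n + 1), (q ^ (p : ℕ) + q ^ (2 * n - p)) = qNumber q (n + 1) * (1 + q ^ n) := by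
  rw [Finset.sum_add_distrib, mul_add, mul_one, qNumber, Finset.sum_range]
  congr 1
  rw [← Equiv.sum_comp Fin.revPerm, Finset.sum_mul]
  refine Finset.sum_congr rfl fun p _ => ?_
  rw [← pow_add]
  congr 1
  have := p.isLt
  simp only [Fin.revPerm_apply, Fin.val_rev]
  omega

/-- The generating function of the inversions over `B(n)`. -/
def poincareB (q : ℝ) (n : ℕ) : ℝ := ∑ σ : typeB n, q ^ inversions σ

/-- A signed permutation of `n + 1` indices is the position and sign of the image of the first index
together with a signed permutation of `n` indices; by `inversions_insertPerm` the inversions add. -/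
theorem poincareB_succ (q : ℝ) (n : ℕ) :
    poincareB q (n + 1) = qNumber q (n + 1) * (1 + q ^ n) * poincareB q n := by
  have hu : ∀ g : ℤˣ → ℝ, ∑ s, g s = g 1 + g (-1) := by
    intro g
    rw [show (Finset.univ : Finset ℤˣ) = {1, -1} from by decide, Finset.sum_pair (by decide)]
  have hB : ∀ m, poincareB q m = ∑ π : Equiv.Perm (Fin m), ∑ ε : Fin m → ℤˣ,
      q ^ inversions (signedPerm π ε) := by
    intro m
    rw [poincareB, ← Equiv.sum_comp (typeBEquiv m), Fintype.sum_prod_type]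
    rfl
  have hn : ¬ (-1 : ℤˣ) = 1 := by decide
  rw [hB, hB, ← Equiv.sum_comp (Equiv.ofBijective _ (insertPerm_bijective n)),
    Fintype.sum_prod_type, ← sum_insertPerm, Finset.sum_mul]
  refine Finset.sum_congr rfl fun p _ => ?_
  rw [Finset.mul_sum]
  refine Finset.sum_congr rfl fun τ _ => ?_
  have hc : ∀ e ε, q ^ inversions (signedPerm (insertPerm (p, τ))
      (Fin.consEquiv (fun _ => ℤˣ) (e, ε))) =
        q ^ (if e = 1 then (p : ℕ) else 2 * n - p) * q ^ inversions (signedPerm τ ε) := by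
    intro e ε
    rw [← pow_add, ← inversions_insertPerm]
    rfl
  rw [← Equiv.sum_comp (Fin.consEquiv fun _ => ℤˣ), Fintype.sum_prod_type, hu]
  simp only [Equiv.ofBijective_apply, hc, if_true, hn, if_false]
  rw [← Finset.mul_sum, ← Finset.mul_sum, add_mul]

/-- The Poincaré polynomial of `D(n)`. -/
def poincareD (q : ℝ) (n : ℕ) : ℝ := ∑ σ : typeD n, q ^ lengthD σ

/-- The last index has height 0, so changing its sign alters no height. -/
theorem inversions_flipB_mul {n : ℕ} (σ : typeB (n + 1)) :
    inversions (flipB (Fin.last n) * σ) = inversions σ := by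
  have h : ∀ a : SignedIndex (n + 1), height ((flipB (Fin.last n)).1 a) = height a := by
    intro a
    rw [flipB_apply]
    by_cases ha : a.1 = Fin.last n
    · simp [height, ha]
    · simp [height, ha]
  simp only [inversions, signDist, rootSign, typeB_mul_apply, h]
  rfl

/-- Left multiplication by the last sign change exchanges the two parity classes and keeps the
inversions. It needs at least one index, hence `n + 1`. -/
theorem poincareB_eq (q : ℝ) (n : ℕ) : poincareB q (n + 1) = 2 * poincareD q (n + 1) := by
  classical
  have h1 : poincareD q (n + 1) =
      ∑ σ : typeB (n + 1) with signParity σ = 1, q ^ inversions σ := by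
    rw [poincareD, Finset.sum_congr rfl fun σ _ => by rw [lengthD_eq]]
    refine Finset.sum_bij' (fun σ _ => σ.1)
      (fun σ hσ => ⟨σ, (mem_typeD_iff σ).2 (Finset.mem_filter.1 hσ).2⟩) ?_ ?_ ?_ ?_ ?_
    · intro σ _
      exact Finset.mem_filter.2 ⟨Finset.mem_univ _, (mem_typeD_iff _).1 σ.2⟩
    all_goals intros; simp
  have h2 : ∑ σ : typeB (n + 1) with ¬ signParity σ = 1, q ^ inversions σ =
      ∑ σ : typeB (n + 1) with signParity σ = 1, q ^ inversions σ := by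
    have hf : flipB (Fin.last n) * flipB (Fin.last n) = 1 := typeB_ext fun a => by
      rw [typeB_mul_apply, flipB_apply, flipB_apply]
      by_cases h : a.1 = Fin.last n <;> simp [h]
      ext <;> simp [h]
    refine Finset.sum_nbij' (fun σ => flipB (Fin.last n) * σ) (fun σ => flipB (Fin.last n) * σ)
      ?_ ?_ ?_ ?_ ?_
    · intro σ hσ
      simp only [Finset.mem_filter, Finset.mem_univ, true_and] at hσ ⊢
      rw [signParity_mul, signParity_flipB, (Int.units_eq_one_or _).resolve_left hσ]
      rfl
    · intro σ hσ
      simp only [Finset.mem_filter, Finset.mem_univ, true_and] at hσ ⊢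
      rw [signParity_mul, signParity_flipB, hσ]
      decide
    · intro σ _; rw [← mul_assoc, hf, one_mul]
    · intro σ _; rw [← mul_assoc, hf, one_mul]
    · intro σ _; rw [inversions_flipB_mul]
  rw [poincareB, ← Finset.sum_filter_add_sum_filter_not _ (fun σ => signParity σ = 1), h2, ← h1]
  ring

theorem poincareD_succ_succ (q : ℝ) (n : ℕ) :
    poincareD q (n + 2) = qNumber q (n + 2) * (1 + q ^ (n + 1)) * poincareD q (n + 1) := by
  have h := poincareB_succ q (n + 1)
  rw [poincareB_eq, poincareB_eq] at h
  linarith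

theorem poincareD_zero (q : ℝ) : poincareD q 0 = 1 := by
  have hs : Subsingleton (typeB 0) := ⟨fun a b => typeB_ext fun x => x.1.elim0⟩
  have h1 : ∀ σ : typeD 0, σ = 1 := fun σ => Subtype.ext (Subsingleton.elim _ _)
  rw [poincareD, Fintype.sum_eq_single 1 fun σ hσ => absurd (h1 σ) hσ, lengthD_eq]
  simp [inversions_one]

theorem poincareD_one (q : ℝ) : poincareD q 1 = 1 := by
  have h := poincareB_succ q 0
  have h0 : poincareB q 0 = 1 := by
    have h1 : ∀ σ : typeB 0, σ = 1 := fun σ => typeB_ext fun x => x.1.elim0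
    rw [poincareB, Fintype.sum_eq_single 1 fun σ hσ => absurd (h1 σ) hσ]
    simp [inversions_one]
  rw [poincareB_eq, h0] at h
  simp [qNumber] at h
  linarith

theorem sum_pow_lengthD (q : ℝ) (n : ℕ) :
    ∑ σ : typeD n, (q : ℂ) ^ lengthD σ = (poincareD q n : ℂ) := by
  simp [poincareD]

variable {H : Type*} [NormedAddCommGroup H] [InnerProductSpace ℂ H]

/-! ### Positivity of the inner product of the tensor powers -/

theorem exists_finiteDimensional_mem_span {n : ℕ} (f : ⨂[ℂ]^n H) :
    ∃ E : Submodule ℂ H, FiniteDimensional ℂ E ∧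
      f ∈ Submodule.span ℂ (PiTensorProduct.tprod ℂ '' {x : Fin n → H | ∀ i, x i ∈ E}) := by
  induction f using PiTensorProduct.induction_on with
  | smul_tprod r x =>
    refine ⟨Submodule.span ℂ (Set.range x), FiniteDimensional.span_of_finite ℂ (Set.finite_range x),
      Submodule.smul_mem _ _ (Submodule.subset_span ⟨x, fun i => ?_, rfl⟩)⟩
    exact Submodule.subset_span ⟨i, rfl⟩
  | add f g hf hg =>
    obtain ⟨E, hE, hf⟩ := hf
    obtain ⟨F, hF, hg⟩ := hg
    refine ⟨E ⊔ F, Submodule.finiteDimensional_sup E F, Submodule.add_mem _ ?_ ?_⟩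
    · refine Submodule.span_mono (Set.image_mono ?_) hf
      intro x hx i
      exact Submodule.mem_sup_left (hx i)
    · refine Submodule.span_mono (Set.image_mono ?_) hg
      intro x hx i
      exact Submodule.mem_sup_right (hx i)

/-- An algebraic tensor involves finitely many vectors, so an orthonormal basis of their span
suffices. The resulting elementary tensors are orthonormal, which makes `tensorInner f f` a sum of
squares of coefficients. -/
theorem exists_orthonormal_expansion {n : ℕ} (f : ⨂[ℂ]^n H) :
    ∃ (d : ℕ) (e : Fin d → H) (c : (Fin n → Fin d) → ℂ), Orthonormal ℂ e ∧
      f = ∑ I, c I • PiTensorProduct.tprod ℂ (fun i => e (I i)) := by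
  classical
  obtain ⟨E, hE, hf⟩ := exists_finiteDimensional_mem_span f
  let b := stdOrthonormalBasis ℂ E
  have hb : Orthonormal ℂ (fun i => (b i : H)) := b.orthonormal.comp_linearIsometry E.subtypeₗᵢ
  refine ⟨Module.finrank ℂ E, fun i => b i, ?_⟩
  suffices h : f ∈ Submodule.span ℂ (Set.range fun I : Fin n → Fin (Module.finrank ℂ E) =>
      PiTensorProduct.tprod ℂ (fun i => (b (I i) : H))) by
    obtain ⟨c, hc⟩ := (Submodule.mem_span_range_iff_exists_fun ℂ).1 h
    exact ⟨c, hb, hc.symm⟩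
  refine Submodule.span_le.2 ?_ hf
  rintro _ ⟨x, hx, rfl⟩
  have hx' : x = fun i => ∑ j, b.repr ⟨x i, hx i⟩ j • (b j : H) := by
    funext i
    have h := b.sum_repr ⟨x i, hx i⟩
    simpa using (congrArg Subtype.val h).symm
  rw [hx', MultilinearMap.map_sum]
  refine Submodule.sum_mem _ fun I _ => ?_
  rw [MultilinearMap.map_smul_univ]
  exact Submodule.smul_mem _ _ (Submodule.subset_span ⟨I, rfl⟩)

theorem tensorInner_self {n : ℕ} (f : ⨂[ℂ]^n H) :
    ∃ r : ℝ, tensorInner f f = r ∧ 0 ≤ r ∧ (f ≠ 0 → 0 < r) := by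
  classical
  obtain ⟨d, e, c, he, hf⟩ := exists_orthonormal_expansion f
  have hortho : ∀ I K : Fin n → Fin d, tensorInner (PiTensorProduct.tprod ℂ fun i => e (I i))
      (PiTensorProduct.tprod ℂ fun i => e (K i)) = if I = K then 1 else 0 := by
    intro I K
    rw [tensorInner_tprod]
    simp only [orthonormal_iff_ite.1 he]
    by_cases h : I = K
    · simp [h]
    · obtain ⟨i, hi⟩ := Function.ne_iff.1 h
      rw [if_neg h]
      exact Finset.prod_eq_zero (Finset.mem_univ i) (if_neg hi)
  refine ⟨∑ I, ‖c I‖ ^ 2, ?_, by positivity, ?_⟩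
  · rw [hf]
    simp only [map_sum, LinearMap.sum_apply, map_smul, map_smulₛₗ, LinearMap.smul_apply, hortho,
      smul_eq_mul, mul_ite, mul_one, mul_zero, Finset.sum_ite_eq', Finset.mem_univ, if_true]
    push_cast
    refine Finset.sum_congr rfl fun I _ => ?_
    rw [← Complex.conj_mul', mul_comm]
  · intro hne
    by_contra hneg
    have h0 : ∑ I, ‖c I‖ ^ 2 = 0 := le_antisymm (not_lt.1 hneg) (by positivity)
    rw [Finset.sum_eq_zero_iff_of_nonneg fun I _ => by positivity] at h0
    refine hne ?_
    rw [hf]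
    refine Finset.sum_eq_zero fun I hI => ?_
    have := h0 I hI
    rw [norm_eq_zero.1 (pow_eq_zero_iff two_ne_zero |>.1 this), zero_smul]

/-! ### The action of `B(n)` on the tensor powers -/

/-- The extension `x_{-k} = J x_k` of a family of vectors to signed indices. -/
def signedExtend (J : H →L[ℂ] H) {n : ℕ} (x : Fin n → H) (a : SignedIndex n) : H :=
  if a.2 = 1 then x a.1 else J (x a.1)

theorem action_tprod (J : H →L[ℂ] H) {n : ℕ} (σ : typeB n) (x : Fin n → H) :
    action J σ (PiTensorProduct.tprod ℂ x) =
      PiTensorProduct.tprod ℂ fun j => signedExtend J x (σ⁻¹.1 (j, 1)) := by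
  rw [action, LinearMap.comp_apply, LinearEquiv.coe_coe, PiTensorProduct.reindex_tprod,
    PiTensorProduct.map_tprod]
  congr 1
  funext j
  simp only [signedExtend]
  split_ifs <;> rfl

theorem signedExtend_negIdx (J : H →L[ℂ] H) (hJ : ∀ y, J (J y) = y) {n : ℕ} (x : Fin n → H)
    (a : SignedIndex n) : signedExtend J x (negIdx a) = J (signedExtend J x a) := by
  have hn : ¬ (-1 : ℤˣ) = 1 := by decide
  rcases Int.units_eq_one_or a.2 with h | h <;> simp [signedExtend, negIdx, h, hn, hJ]

theorem signedExtend_comp (J : H →L[ℂ] H) (hJ : ∀ y, J (J y) = y) {n : ℕ} (x : Fin n → H)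
    (τ : typeB n) (a : SignedIndex n) :
    signedExtend J (fun i => signedExtend J x (τ.1 (i, 1))) a = signedExtend J x (τ.1 a) := by
  rcases Int.units_eq_one_or a.2 with h | h
  · have : a = (a.1, 1) := Prod.ext rfl h
    rw [this]
    exact if_pos rfl
  · have : a = negIdx (a.1, 1) := Prod.ext rfl h
    rw [this, signedExtend_negIdx J hJ, typeB_negIdx, signedExtend_negIdx J hJ]
    exact congrArg J (if_pos rfl)

theorem action_mul (J : H →L[ℂ] H) (hJ : ∀ y, J (J y) = y) {n : ℕ} (σ τ : typeB n) :
    action J (σ * τ) = action J σ ∘ₗ action J τ := by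
  refine PiTensorProduct.ext (MultilinearMap.ext fun x => ?_)
  simp only [LinearMap.compMultilinearMap_apply, LinearMap.comp_apply, action_tprod,
    signedExtend_comp J hJ]
  rw [mul_inv_rev]
  rfl

theorem action_one (J : H →L[ℂ] H) {n : ℕ} : action J (1 : typeB n) = LinearMap.id := by
  refine PiTensorProduct.ext (MultilinearMap.ext fun x => ?_)
  rw [LinearMap.compMultilinearMap_apply, action_tprod]
  simp [signedExtend]

theorem tensorInner_action (J : H →L[ℂ] H) (hJ : ∀ x y, inner ℂ (J x) (J y) = inner ℂ x y) {n : ℕ}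
    (σ : typeB n) (f g : ⨂[ℂ]^n H) :
    tensorInner (action J σ f) (action J σ g) = tensorInner f g := by
  induction f using PiTensorProduct.induction_on with
  | add f f' hf hf' => simp only [map_add, LinearMap.add_apply, hf, hf']
  | smul_tprod r x =>
    induction g using PiTensorProduct.induction_on with
    | add g g' hg hg' => simp only [map_add, hg, hg']
    | smul_tprod s y =>
      have h : ∀ a : SignedIndex n, inner ℂ (signedExtend J x a) (signedExtend J y a) =
          inner ℂ (x a.1) (y a.1) := by
        intro a
        simp only [signedExtend]
        split_ifs
        · rfl
        · exact hJ _ _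
      simp only [map_smul, map_smulₛₗ, LinearMap.smul_apply, action_tprod, tensorInner_tprod, h]
      exact congrArg (fun z => s • (starRingEnd ℂ) r • z)
        (Equiv.prod_comp (absPerm σ⁻¹) fun i => inner ℂ (x i) (y i))

/-! ### Positivity of the symmetrizer -/

/-- The Walsh function of a set `c` of roots, evaluated at the chamber of `σ`. -/
def walsh {n : ℕ} (c : Finset (SignedIndex n × SignedIndex n)) (σ : typeB n) : ℤ :=
  ∏ p ∈ c, rootSign (σ⁻¹.1 p.1) (σ⁻¹.1 p.2)

/-- The coefficients of the expansion of `q ^ ℓ` in Walsh functions. -/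
def walshWeight (q : ℝ) {n : ℕ} (c : Finset (SignedIndex n × SignedIndex n)) : ℝ :=
  (∏ _p ∈ c, (1 - q) / 2) * ∏ _p ∈ posRoots n \ c, (1 + q) / 2

theorem walshWeight_pos {q : ℝ} (hq : q ∈ Set.Ioo (-1 : ℝ) 1) {n : ℕ}
    (c : Finset (SignedIndex n × SignedIndex n)) : 0 < walshWeight q c := by
  have h1 : 0 < (1 - q) / 2 := by linarith [hq.2]
  have h2 : 0 < (1 + q) / 2 := by linarith [hq.1]
  exact mul_pos (Finset.prod_pos fun _ _ => h1) (Finset.prod_pos fun _ _ => h2)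

/-- A single root contributes 1 or q according to whether its signs agree, that is (1+q)/2 plus
(1-q)/2 times their product. Expanding the product over the positive roots gives one term for each
set of roots. -/
theorem pow_inversions_eq_sum_walsh (q : ℝ) {n : ℕ} (σ τ : typeB n) :
    q ^ inversions (σ⁻¹ * τ) =
      ∑ c ∈ (posRoots n).powerset, walshWeight q c * (walsh c σ * walsh c τ : ℤ) := by
  have h : ∀ p ∈ posRoots n,
      q ^ (if rootSign (τ⁻¹.1 p.1) (τ⁻¹.1 p.2) = rootSign (σ⁻¹.1 p.1) (σ⁻¹.1 p.2) then 0 else 1) =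
        (1 - q) / 2 * (rootSign (σ⁻¹.1 p.1) (σ⁻¹.1 p.2) * rootSign (τ⁻¹.1 p.1) (τ⁻¹.1 p.2) : ℤ) +
          (1 + q) / 2 := by
    intro p hp
    have hne := fst_ne_of_mem_posRoots hp
    rcases rootSign_eq_one_or (typeB_fst_ne σ⁻¹ hne) with h1 | h1 <;>
    rcases rootSign_eq_one_or (typeB_fst_ne τ⁻¹ hne) with h2 | h2 <;>
    · rw [h1, h2]
      norm_num
      try ring
  rw [inversions_inv_mul, signDist, ← Finset.prod_pow_eq_pow_sum, Finset.prod_congr rfl h,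
    Finset.prod_add]
  refine Finset.sum_congr rfl fun c _ => ?_
  rw [walshWeight, walsh, walsh]
  push_cast
  rw [Finset.prod_mul_distrib, Finset.prod_mul_distrib]
  ring

/-- The sum over subsets factors as the product of 1 + ε_p(σ). One negative sign kills it, and only
the identity of D(n) has none. -/
theorem sum_walsh {n : ℕ} (σ : typeD n) :
    ∑ c ∈ (posRoots n).powerset, walsh c (σ : typeB n) =
      if σ = 1 then 2 ^ (posRoots n).card else 0 := by
  have h := Finset.prod_add (fun p => rootSign ((σ : typeB n)⁻¹.1 p.1) ((σ : typeB n)⁻¹.1 p.2))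
    (fun _ => (1 : ℤ)) (posRoots n)
  simp only [Finset.prod_const_one, mul_one] at h
  simp only [walsh]
  rw [← h]
  split_ifs with h1
  · rw [h1, ← Finset.prod_const]
    refine Finset.prod_congr rfl fun p hp => ?_
    simp [rootSign_of_mem hp]
  · by_contra hne
    refine h1 (Subtype.ext (eq_of_signDist_eq_zero (n := n) σ.2 (one_mem _) ?_))
    rw [signDist]
    refine Finset.sum_eq_zero fun p hp => if_pos ?_
    rcases rootSign_eq_one_or (typeB_fst_ne (σ : typeB n)⁻¹ (fst_ne_of_mem_posRoots hp)) with h2 | h2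
    · rw [h2]; simp [rootSign_of_mem hp]
    · exact absurd (Finset.prod_eq_zero hp (by rw [h2]; rfl)) hne

/-- The part of `∑ σ f` that belongs to a Walsh function. -/
def walshVector (J : H →L[ℂ] H) {n : ℕ} (c : Finset (SignedIndex n × SignedIndex n))
    (f : ⨂[ℂ]^n H) : ⨂[ℂ]^n H :=
  ∑ σ : typeD n, (walsh c (σ : typeB n) : ℂ) • action J (σ : typeB n) f

theorem sum_walshVector (J : H →L[ℂ] H) {n : ℕ} (f : ⨂[ℂ]^n H) :
    ∑ c ∈ (posRoots n).powerset, walshVector J c f = (2 : ℂ) ^ (posRoots n).card • f := by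
  simp only [walshVector]
  rw [Finset.sum_comm, Fintype.sum_eq_single (1 : typeD n)]
  · rw [← Finset.sum_smul, ← Int.cast_sum, sum_walsh, if_pos rfl]
    simp [action_one]
  · intro σ hσ
    rw [← Finset.sum_smul, ← Int.cast_sum, sum_walsh, if_neg hσ, Int.cast_zero, zero_smul]

/-- Since the action is isometric, averaging over D(n) rewrites the form as a double sum of
q^{ℓ(σ⁻¹τ)} ⟨σf, τf⟩, and the Walsh expansion of the kernel separates σ from τ. -/
theorem card_mul_tensorInner_symmetrizer (q : ℝ) (J : H →L[ℂ] H) (hJ : ∀ y, J (J y) = y)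
    (hJ' : ∀ x y, inner ℂ (J x) (J y) = inner ℂ x y) {n : ℕ} (f : ⨂[ℂ]^n H) :
    (Fintype.card (typeD n) : ℂ) * tensorInner f (symmetrizer q J n f) =
      ∑ c ∈ (posRoots n).powerset,
        (walshWeight q c : ℂ) * tensorInner (walshVector J c f) (walshVector J c f) := by
  have h1 : ∀ σ : typeD n, tensorInner f (symmetrizer q J n f) =
      ∑ τ : typeD n, (q : ℂ) ^ inversions ((σ : typeB n)⁻¹ * (τ : typeB n)) *
        tensorInner (action J (σ : typeB n) f) (action J (τ : typeB n) f) := by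
    intro σ
    rw [← Equiv.sum_comp (Equiv.mulLeft σ), symmetrizer, LinearMap.sum_apply, map_sum]
    refine Finset.sum_congr rfl fun τ _ => ?_
    rw [LinearMap.smul_apply, map_smul, smul_eq_mul, lengthD_eq, Equiv.coe_mulLeft,
      Subgroup.coe_mul, inv_mul_cancel_left, action_mul J hJ, LinearMap.comp_apply,
      tensorInner_action J hJ']
  have h2 : (Fintype.card (typeD n) : ℂ) * tensorInner f (symmetrizer q J n f) =
      ∑ σ : typeD n, ∑ τ : typeD n, (q : ℂ) ^ inversions ((σ : typeB n)⁻¹ * (τ : typeB n)) *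
        tensorInner (action J (σ : typeB n) f) (action J (τ : typeB n) f) := by
    rw [← Finset.sum_congr rfl fun σ _ => h1 σ, Finset.sum_const, Finset.card_univ, nsmul_eq_mul]
  have h3 : ∀ σ τ : typeB n, (q : ℂ) ^ inversions (σ⁻¹ * τ) =
      ∑ c ∈ (posRoots n).powerset, (walshWeight q c : ℂ) * (walsh c σ * walsh c τ) := by
    intro σ τ
    have := congrArg (fun r : ℝ => (r : ℂ)) (pow_inversions_eq_sum_walsh q σ τ)
    push_cast at this
    exact this
  rw [h2]
  simp only [h3, Finset.sum_mul]
  rw [Finset.sum_congr rfl fun σ _ => Finset.sum_comm, Finset.sum_comm]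
  refine Finset.sum_congr rfl fun c _ => ?_
  simp only [walshVector, map_sum, LinearMap.sum_apply, Finset.mul_sum, map_smul, map_smulₛₗ,
    LinearMap.smul_apply, map_intCast, smul_eq_mul]
  rw [Finset.sum_comm]
  exact Finset.sum_congr rfl fun σ _ => Finset.sum_congr rfl fun τ _ => by ring

theorem tensorInner_symmetrizer_self {q : ℝ} (hq : q ∈ Set.Ioo (-1 : ℝ) 1) (J : H →L[ℂ] H)
    (hJ : ∀ y, J (J y) = y) (hJ' : ∀ x y, inner ℂ (J x) (J y) = inner ℂ x y) {n : ℕ}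
    (f : ⨂[ℂ]^n H) :
    ∃ r : ℝ, tensorInner f (symmetrizer q J n f) = r ∧ 0 ≤ r ∧ (f ≠ 0 → 0 < r) := by
  choose r hr hr0 hrpos using fun c => tensorInner_self (walshVector J c f)
  have hcard : (0 : ℝ) < Fintype.card (typeD n) := by exact_mod_cast Fintype.card_pos
  have h := card_mul_tensorInner_symmetrizer q J hJ hJ' f
  have hnn : ∀ c, 0 ≤ walshWeight q c * r c := fun c =>
    mul_nonneg (walshWeight_pos hq c).le (hr0 c)
  refine ⟨(∑ c ∈ (posRoots n).powerset, walshWeight q c * r c) / Fintype.card (typeD n), ?_,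
    div_nonneg (Finset.sum_nonneg fun c _ => hnn c) hcard.le, fun hf => div_pos ?_ hcard⟩
  · have hc : (Fintype.card (typeD n) : ℂ) ≠ 0 := by exact_mod_cast hcard.ne'
    push_cast
    rw [eq_div_iff hc, mul_comm, h]
    exact Finset.sum_congr rfl fun c _ => by rw [hr]
  · refine Finset.sum_pos' (fun c _ => hnn c) ?_
    by_contra hcon
    push Not at hcon
    -- All weights are strictly positive, so a vanishing form kills every Walsh component; these add
    -- up to a nonzero multiple of `f`.
    have hv : ∀ c ∈ (posRoots n).powerset, walshVector J c f = 0 := by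
      intro c hc
      by_contra hne
      exact absurd (mul_pos (walshWeight_pos hq c) (hrpos c hne)) (not_lt.2 (hcon c hc))
    have := sum_walshVector J f
    rw [Finset.sum_eq_zero hv] at this
    exact hf ((smul_eq_zero.1 this.symm).resolve_left (pow_ne_zero _ two_ne_zero))

/-! ### The inner product of the Fock space and the annihilation operator -/

theorem fockInner_lof (q : ℝ) (J : H →L[ℂ] H) (f : Fock H) (n : ℕ) (y : ⨂[ℂ]^n H) :
    fockInner q J f (DirectSum.lof ℂ ℕ (fun n => ⨂[ℂ]^n H) n y) =
      tensorInner (f n) (symmetrizer q J n y) := by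
  simp only [fockInner, LinearMap.coe_mk, AddHom.coe_mk]
  rw [DirectSum.toModule_lof]
  rfl

theorem fockInner_self {q : ℝ} (hq : q ∈ Set.Ioo (-1 : ℝ) 1) (J : H →L[ℂ] H)
    (hJ : ∀ y, J (J y) = y) (hJ' : ∀ x y, inner ℂ (J x) (J y) = inner ℂ x y) {f : Fock H}
    (hf : f ≠ 0) : 0 < (fockInner q J f f).re ∧ (fockInner q J f f).im = 0 := by
  classical
  choose r hr hr0 hrpos using fun n => tensorInner_symmetrizer_self hq J hJ hJ' (f n)
  have h : fockInner q J f f = ((∑ n ∈ DFinsupp.support f, r n : ℝ) : ℂ) := by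
    have hsum : fockInner q J f f = fockInner q J f (∑ n ∈ DFinsupp.support f,
        DirectSum.lof ℂ ℕ (fun n => ⨂[ℂ]^n H) n (f n)) := by
      congr 1
      exact (DirectSum.sum_support_of f).symm
    rw [hsum, map_sum]
    push_cast
    exact Finset.sum_congr rfl fun n _ => by rw [fockInner_lof, hr]
  rw [h, Complex.ofReal_re, Complex.ofReal_im]
  refine ⟨?_, rfl⟩
  obtain ⟨n, hn⟩ : ∃ n, f n ≠ 0 := by
    by_contra hcon
    push Not at hcon
    exact hf (DFinsupp.ext hcon)
  exact Finset.sum_pos' (fun n _ => hr0 n) ⟨n, DFinsupp.mem_support_iff.2 hn, hrpos n hn⟩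

theorem fockInner_ext {q : ℝ} (hq : q ∈ Set.Ioo (-1 : ℝ) 1) (J : H →L[ℂ] H)
    (hJ : ∀ y, J (J y) = y) (hJ' : ∀ x y, inner ℂ (J x) (J y) = inner ℂ x y) {v w : Fock H}
    (h : ∀ f, fockInner q J f v = fockInner q J f w) : v = w := by
  by_contra hne
  have h1 := (fockInner_self hq J hJ hJ' (sub_ne_zero.2 hne)).1
  rw [map_sub, h, sub_self, Complex.zero_re] at h1
  exact lt_irrefl _ h1

theorem symmetrizer_injective {q : ℝ} (hq : q ∈ Set.Ioo (-1 : ℝ) 1) (J : H →L[ℂ] H)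
    (hJ : ∀ y, J (J y) = y) (hJ' : ∀ x y, inner ℂ (J x) (J y) = inner ℂ x y) (n : ℕ) :
    Function.Injective (symmetrizer q J n) := by
  rw [injective_iff_map_eq_zero]
  intro f hf
  by_contra hne
  obtain ⟨r, hr, _, hpos⟩ := tensorInner_symmetrizer_self hq J hJ hJ' f
  rw [hf, map_zero] at hr
  exact (hpos hne).ne (by exact_mod_cast hr)

/-- The tensor power may be infinite-dimensional, but the span of the D(n)-orbit of `g` is
finite-dimensional and stable under the symmetrizer; there injectivity implies surjectivity. -/
theorem symmetrizer_surjective {q : ℝ} (hq : q ∈ Set.Ioo (-1 : ℝ) 1) (J : H →L[ℂ] H)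
    (hJ : ∀ y, J (J y) = y) (hJ' : ∀ x y, inner ℂ (J x) (J y) = inner ℂ x y) (n : ℕ) :
    Function.Surjective (symmetrizer q J n) := by
  intro g
  let S : Submodule ℂ (⨂[ℂ]^n H) :=
    Submodule.span ℂ (Set.range fun σ : typeD n => action J (σ : typeB n) g)
  have : FiniteDimensional ℂ S := FiniteDimensional.span_of_finite ℂ (Set.finite_range _)
  have hS : ∀ v ∈ S, symmetrizer q J n v ∈ S := by
    intro v hv
    rw [symmetrizer, LinearMap.sum_apply]
    refine Submodule.sum_mem _ fun τ _ => ?_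
    rw [LinearMap.smul_apply]
    refine Submodule.smul_mem _ _ ?_
    have hle : S ≤ S.comap (action J (τ : typeB n)) := by
      refine Submodule.span_le.2 ?_
      rintro _ ⟨σ, rfl⟩
      refine Submodule.subset_span ⟨τ * σ, ?_⟩
      simp only [Subgroup.coe_mul, action_mul J hJ, LinearMap.comp_apply]
    exact hle hv
  have hinj : Function.Injective ((symmetrizer q J n).restrict hS) := by
    intro a b hab
    exact Subtype.ext (symmetrizer_injective hq J hJ hJ' n (congrArg Subtype.val hab))
  have hg : g ∈ S := Submodule.subset_span ⟨1, by simp [action_one]⟩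
  obtain ⟨f, hf⟩ := LinearMap.surjective_of_injective hinj ⟨g, hg⟩
  exact ⟨f, congrArg Subtype.val hf⟩

/-- The free annihilation operator `x_0 ⊗ ⋯ ⊗ x_n ↦ ⟨x, x_0⟩ x_1 ⊗ ⋯ ⊗ x_n`. -/
def tensorUncons (x : H) (n : ℕ) : (⨂[ℂ]^(n + 1) H) →ₗ[ℂ] (⨂[ℂ]^n H) :=
  PiTensorProduct.lift
    (LinearMap.uncurryLeft
      ((innerSL ℂ x : H →ₗ[ℂ] ℂ).smulRight
        (PiTensorProduct.tprod ℂ : MultilinearMap ℂ (fun _ : Fin n => H) _)))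

theorem tensorUncons_tprod (x : H) {n : ℕ} (y : Fin (n + 1) → H) :
    tensorUncons x n (PiTensorProduct.tprod ℂ y) =
      inner ℂ x (y 0) • PiTensorProduct.tprod ℂ (Fin.tail y) := by
  simp [tensorUncons]

theorem tensorCons_tprod (x : H) {n : ℕ} (y : Fin n → H) :
    tensorCons x n (PiTensorProduct.tprod ℂ y) =
      PiTensorProduct.tprod ℂ (Fin.cons x y : Fin (n + 1) → H) := by
  simp [tensorCons]

theorem tensorInner_tensorCons (x : H) {n : ℕ} (f : ⨂[ℂ]^n H) (g : ⨂[ℂ]^(n + 1) H) :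
    tensorInner (tensorCons x n f) g = tensorInner f (tensorUncons x n g) := by
  induction f using PiTensorProduct.induction_on with
  | add f f' hf hf' => simp only [map_add, LinearMap.add_apply, hf, hf']
  | smul_tprod r y =>
    induction g using PiTensorProduct.induction_on with
    | add g g' hg hg' => simp only [map_add, hg, hg']
    | smul_tprod s z =>
      simp only [map_smul, map_smulₛₗ, LinearMap.smul_apply, tensorUncons_tprod, tensorCons_tprod,
        tensorInner_tprod, Fin.prod_univ_succ, Fin.cons_zero, Fin.cons_succ, smul_eq_mul,
        Fin.tail]
      ring

theorem creation_apply_succ (x : H) (f : Fock H) (n : ℕ) :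
    creation x f (n + 1) = tensorCons x n (f n) := by
  induction f using DirectSum.induction_on with
  | zero => simp
  | add f g hf hg => rw [map_add, DirectSum.add_apply, hf, hg, DirectSum.add_apply, map_add]
  | of m y =>
    change creation x (DirectSum.lof ℂ ℕ (fun n => ⨂[ℂ]^n H) m y) (n + 1) = tensorCons x n
      (DirectSum.lof ℂ ℕ (fun n => ⨂[ℂ]^n H) m y n)
    rw [creation, DirectSum.toModule_lof, LinearMap.comp_apply]
    by_cases h : m = n
    · subst h
      rw [DirectSum.lof_apply, DirectSum.lof_apply]
    · rw [DirectSum.lof_eq_of, DirectSum.lof_eq_of,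
        DirectSum.of_eq_of_ne _ _ _ (by omega), DirectSum.of_eq_of_ne _ _ _ (by omega), map_zero]

theorem creation_apply_zero (x : H) (f : Fock H) : creation x f 0 = 0 := by
  induction f using DirectSum.induction_on with
  | zero => simp
  | add f g hf hg => rw [map_add, DirectSum.add_apply, hf, hg, add_zero]
  | of m y =>
    change creation x (DirectSum.lof ℂ ℕ (fun n => ⨂[ℂ]^n H) m y) 0 = 0
    rw [creation, DirectSum.toModule_lof, LinearMap.comp_apply, DirectSum.lof_eq_of,
      DirectSum.of_eq_of_ne _ _ _ (by omega)]

theorem exists_isAdjointOfCreation {q : ℝ} (hq : q ∈ Set.Ioo (-1 : ℝ) 1) (J : H →L[ℂ] H)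
    (hJ : ∀ y, J (J y) = y) (hJ' : ∀ x y, inner ℂ (J x) (J y) = inner ℂ x y) (x : H) :
    ∃ A, IsAdjointOfCreation q J x A := by
  let P : ∀ n, (⨂[ℂ]^n H) ≃ₗ[ℂ] (⨂[ℂ]^n H) := fun n =>
    LinearEquiv.ofBijective (symmetrizer q J n)
      ⟨symmetrizer_injective hq J hJ hJ' n, symmetrizer_surjective hq J hJ hJ' n⟩
  have hP : ∀ n y, symmetrizer q J n ((P n).symm y) = y := fun n y => (P n).apply_symm_apply y
  let A : ∀ n, (⨂[ℂ]^n H) →ₗ[ℂ] Fock H := fun n => match n with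
    | 0 => 0
    | n + 1 => DirectSum.lof ℂ ℕ (fun n => ⨂[ℂ]^n H) n ∘ₗ (P n).symm.toLinearMap ∘ₗ
        tensorUncons x n ∘ₗ symmetrizer q J (n + 1)
  refine ⟨DirectSum.toModule ℂ ℕ (Fock H) A, fun f g => ?_⟩
  induction g using DirectSum.induction_on with
  | zero => simp
  | add g g' hg hg' => rw [map_add, map_add, hg, hg', map_add]
  | of m y =>
    change fockInner q J f (DirectSum.toModule ℂ ℕ (Fock H) A
      (DirectSum.lof ℂ ℕ (fun n => ⨂[ℂ]^n H) m y)) = fockInner q J (creation x f)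
      (DirectSum.lof ℂ ℕ (fun n => ⨂[ℂ]^n H) m y)
    rw [DirectSum.toModule_lof, fockInner_lof]
    cases m with
    | zero =>
      rw [creation_apply_zero]
      simp [A]
    | succ n =>
      rw [creation_apply_succ, tensorInner_tensorCons]
      change fockInner q J f (DirectSum.lof ℂ ℕ (fun n => ⨂[ℂ]^n H) n ((P n).symm
        (tensorUncons x n (symmetrizer q J (n + 1) y)))) = _
      rw [fockInner_lof, hP]

theorem isAdjointOfCreation_annihilation {q : ℝ} (hq : q ∈ Set.Ioo (-1 : ℝ) 1) (J : H →L[ℂ] H)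
    (hJ : ∀ y, J (J y) = y) (hJ' : ∀ x y, inner ℂ (J x) (J y) = inner ℂ x y) (x : H) :
    IsAdjointOfCreation q J x (annihilation q J x) := by
  have h := exists_isAdjointOfCreation hq J hJ hJ' x
  rw [annihilation, dif_pos h]
  exact h.choose_spec

/-! ### The orbit of the vacuum under the Gaussian operator -/

/-- The vector `x ⊗ ⋯ ⊗ x` of the Fock space. -/
def tensorPow (x : H) (n : ℕ) : Fock H :=
  DirectSum.lof ℂ ℕ (fun n => ⨂[ℂ]^n H) n (PiTensorProduct.tprod ℂ fun _ => x)

theorem vacuum_eq_tensorPow (x : H) : vacuum = tensorPow x 0 := by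
  rw [vacuum, tensorPow]
  congr 2
  exact Subsingleton.elim _ _

theorem creation_tensorPow (x : H) (n : ℕ) : creation x (tensorPow x n) = tensorPow x (n + 1) := by
  rw [creation, tensorPow, DirectSum.toModule_lof, LinearMap.comp_apply, tensorCons_tprod,
    tensorPow]
  congr 2
  funext i
  refine Fin.cases rfl (fun i => rfl) i

/-- When `J x = -x`, the signs multiply to the sign parity of `σ⁻¹`, which is 1 on D(n). -/
theorem action_tprod_const (J : H →L[ℂ] H) {x : H} (hx : J x = x ∨ J x = -x) {n : ℕ}
    {σ : typeB n} (hσ : σ ∈ typeD n) :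
    action J σ (PiTensorProduct.tprod ℂ fun _ => x) = PiTensorProduct.tprod ℂ fun _ => x := by
  rw [action_tprod]
  rcases hx with hx | hx
  · congr 1
    funext j
    simp [signedExtend, hx]
  · have h : ∀ j, signedExtend J (fun _ => x) (σ⁻¹.1 (j, 1)) =
        (((σ⁻¹.1 (j, 1)).2 : ℤ) : ℂ) • x := by
      intro j
      have hn : ¬ (-1 : ℤˣ) = 1 := by decide
      rcases Int.units_eq_one_or (σ⁻¹.1 (j, 1)).2 with h | h
      · rw [signedExtend, if_pos h, h]; simp
      · rw [signedExtend, h, if_neg hn, hx]; simp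
    have hpar := (mem_typeD_iff _).1 (inv_mem hσ)
    rw [funext h, MultilinearMap.map_smul_univ]
    have : (∏ j, (((σ⁻¹.1 (j, 1)).2 : ℤ) : ℂ)) = ((signParity σ⁻¹ : ℤ) : ℂ) := by
      simp [signParity, Units.coe_prod]
    rw [this, hpar]
    simp

theorem symmetrizer_tprod_const (q : ℝ) (J : H →L[ℂ] H) {x : H} (hx : J x = x ∨ J x = -x)
    (n : ℕ) : symmetrizer q J n (PiTensorProduct.tprod ℂ fun _ => x) =
      (poincareD q n : ℂ) • PiTensorProduct.tprod ℂ fun _ => x := by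
  rw [symmetrizer, LinearMap.sum_apply, ← sum_pow_lengthD, Finset.sum_smul]
  refine Finset.sum_congr rfl fun σ _ => ?_
  rw [LinearMap.smul_apply, action_tprod_const J hx σ.2]

/-- The coefficients of the recursion of `polyD`. -/
def jacobiCoeff (q : ℝ) : ℕ → ℝ
  | 0 => 1
  | n + 1 => qNumber q (n + 2) * (1 + q ^ (n + 1))

/-- At index 0 the formula [n+1]_q (1+q^n) would give 2. The value 1 in `jacobiCoeff` absorbs the
exceptional P_2 and matches the triviality of D(1). -/
theorem polyD_succ_succ (q : ℝ) (n : ℕ) :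
    polyD q (n + 2) =
      Polynomial.X * polyD q (n + 1) - Polynomial.C (jacobiCoeff q n) * polyD q n := by
  cases n with
  | zero => simp [polyD, jacobiCoeff, sq]
  | succ n => rfl

theorem poincareD_succ (q : ℝ) (n : ℕ) :
    poincareD q (n + 1) = jacobiCoeff q n * poincareD q n := by
  cases n with
  | zero => simp [jacobiCoeff, poincareD_zero, poincareD_one]
  | succ n => exact poincareD_succ_succ q n

theorem annihilation_tensorPow_zero {q : ℝ} (hq : q ∈ Set.Ioo (-1 : ℝ) 1) {J : H →L[ℂ] H} (hJ : ∀ y, J (J y) = y)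
    (hJ' : ∀ x y, inner ℂ (J x) (J y) = inner ℂ x y) (x : H) :
    annihilation q J x (tensorPow x 0) = 0 := by
  refine fockInner_ext hq J hJ hJ' fun f => ?_
  rw [isAdjointOfCreation_annihilation hq J hJ hJ' x, tensorPow, fockInner_lof,
    creation_apply_zero]
  simp

/-- Paired with any `f`, both sides give the free inner product of `f n` with `x ⊗ ⋯ ⊗ x`, times
`poincareD q (n + 1)` on the left and `jacobiCoeff q n * poincareD q n` on the right. -/
theorem annihilation_tensorPow_succ {q : ℝ} (hq : q ∈ Set.Ioo (-1 : ℝ) 1) {J : H →L[ℂ] H} (hJ : ∀ y, J (J y) = y)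
    (hJ' : ∀ x y, inner ℂ (J x) (J y) = inner ℂ x y) {x : H} (hx_norm : ‖x‖ = 1)
    (hx : J x = x ∨ J x = -x) (n : ℕ) :
   
    annihilation q J x (tensorPow x (n + 1)) = (jacobiCoeff q n : ℂ) • tensorPow x n := by
  refine fockInner_ext hq J hJ hJ' fun f => ?_
  rw [isAdjointOfCreation_annihilation hq J hJ hJ' x, map_smul, tensorPow, tensorPow,
    fockInner_lof, fockInner_lof, creation_apply_succ, tensorInner_tensorCons,
    symmetrizer_tprod_const q J hx, symmetrizer_tprod_const q J hx, map_smul, map_smul, map_smul,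
    tensorUncons_tprod, inner_self_eq_norm_sq_to_K, hx_norm, poincareD_succ]
  have h : (Fin.tail fun _ : Fin (n + 1) => x) = fun _ => x := rfl
  rw [h]
  simp [mul_assoc]

theorem gaussian_tensorPow_succ {q : ℝ} (hq : q ∈ Set.Ioo (-1 : ℝ) 1) {J : H →L[ℂ] H} (hJ : ∀ y, J (J y) = y)
    (hJ' : ∀ x y, inner ℂ (J x) (J y) = inner ℂ x y) {x : H} (hx_norm : ‖x‖ = 1)
    (hx : J x = x ∨ J x = -x) (n : ℕ) :
    gaussian q J x (tensorPow x (n + 1)) =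
    tensorPow x (n + 2) + (jacobiCoeff q n : ℂ) • tensorPow x n := by
  rw [gaussian, LinearMap.add_apply, annihilation_tensorPow_succ hq hJ hJ' hx_norm hx,
    creation_tensorPow, add_comm]

theorem aeval_polyD_vacuum {q : ℝ} (hq : q ∈ Set.Ioo (-1 : ℝ) 1) {J : H →L[ℂ] H} (hJ : ∀ y, J (J y) = y)
    (hJ' : ∀ x y, inner ℂ (J x) (J y) = inner ℂ x y) {x : H} (hx_norm : ‖x‖ = 1)
    (hx : J x = x ∨ J x = -x) (n : ℕ) :
   
    Polynomial.aeval (gaussian q J x) ((polyD q n).map (algebraMap ℝ ℂ)) vacuum =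
      tensorPow x n := by
  induction n using Nat.strong_induction_on with
  | _ n ih =>
    match n with
    | 0 => simp [polyD, vacuum_eq_tensorPow x]
    | 1 =>
      simp only [polyD, Polynomial.map_X, Polynomial.aeval_X]
      rw [vacuum_eq_tensorPow x, gaussian, LinearMap.add_apply,
        annihilation_tensorPow_zero hq hJ hJ' x, creation_tensorPow, zero_add]
    | n + 2 =>
      rw [polyD_succ_succ, Polynomial.map_sub, Polynomial.map_mul, Polynomial.map_mul,
        Polynomial.map_X, Polynomial.map_C, map_sub, map_mul, map_mul, Polynomial.aeval_X,
        Polynomial.aeval_C, LinearMap.sub_apply, Module.End.mul_apply, Module.End.mul_apply,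
        ih (n + 1) (by omega), ih n (by omega), Module.algebraMap_end_apply,
        gaussian_tensorPow_succ hq hJ hJ' hx_norm hx]
      exact add_sub_cancel_right _ _

theorem fockInner_vacuum_tensorPow (q : ℝ) {J : H →L[ℂ] H} {x : H}
    (hx : J x = x ∨ J x = -x) (n : ℕ) :
    fockInner q J vacuum (tensorPow x n) = if n = 0 then 1 else 0 := by
  rw [tensorPow, fockInner_lof, symmetrizer_tprod_const q J hx]
  split_ifs with h
  · subst h
    rw [poincareD_zero, vacuum, DirectSum.lof_apply, map_smul, tensorInner_tprod]
    simp
  · have : (vacuum : Fock H) n = 0 := by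
      rw [vacuum, DirectSum.lof_eq_of, DirectSum.of_eq_of_ne _ _ _ (by omega)]
    rw [this]
    simp

/-! ### Moments and compactly supported measures -/

theorem integrable_of_compactSupport {μ : Measure ℝ} [IsProbabilityMeasure μ] {R : ℝ}
    (hμ : μ (Set.Icc (-R) R)ᶜ = 0) {f : ℝ → ℝ} (hf : Continuous f) : Integrable f μ := by
  have hr : μ.restrict (Set.Icc (-R) R) = μ := Measure.restrict_eq_self_of_ae_mem hμ
  rw [← hr]
  exact hf.continuousOn.integrableOn_compact isCompact_Icc

/-- Markov's inequality for t^{2n} at level (2R)^{2n} bounds the outer mass by 4^{-n} for every n.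
-/
theorem measure_compl_Icc_eq_zero {ν : Measure ℝ} [IsProbabilityMeasure ν] {R : ℝ} (hR : 0 < R)
    (hint : ∀ n : ℕ, Integrable (fun t : ℝ => t ^ n) ν)
    (hbound : ∀ n : ℕ, ∫ t, t ^ (2 * n) ∂ν ≤ R ^ (2 * n)) :
    ν (Set.Icc (-(2 * R)) (2 * R))ᶜ = 0 := by
  have hsub : ∀ n : ℕ, (Set.Icc (-(2 * R)) (2 * R))ᶜ ⊆ {t : ℝ | (2 * R) ^ (2 * n) ≤ t ^ (2 * n)} := by
    intro n t ht
    have : 2 * R < |t| := by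
      by_contra hcon
      exact ht (abs_le.1 (not_lt.1 hcon))
    show (2 * R) ^ (2 * n) ≤ t ^ (2 * n)
    rw [← Even.pow_abs (even_two_mul n) t]
    exact pow_le_pow_left₀ (by positivity) this.le _
  have hle : ∀ n : ℕ, ν.real (Set.Icc (-(2 * R)) (2 * R))ᶜ ≤ (1 / 4 : ℝ) ^ n := by
    intro n
    have h1 := mul_meas_ge_le_integral_of_nonneg (μ := ν) (f := fun t : ℝ => t ^ (2 * n))
      (Filter.Eventually.of_forall fun t => (even_two_mul n).pow_nonneg t) (hint _)
      ((2 * R) ^ (2 * n))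
    have h2 : ν.real (Set.Icc (-(2 * R)) (2 * R))ᶜ ≤
        ν.real {t : ℝ | (2 * R) ^ (2 * n) ≤ t ^ (2 * n)} := measureReal_mono (hsub n)
    have h3 : (2 * R) ^ (2 * n) * ν.real (Set.Icc (-(2 * R)) (2 * R))ᶜ ≤ R ^ (2 * n) :=
      (mul_le_mul_of_nonneg_left h2 (by positivity)).trans (h1.trans (hbound n))
    have hRn : 0 < R ^ (2 * n) := by positivity
    rw [mul_pow, pow_mul 2 2 n] at h3
    have h4 : (2 ^ 2 : ℝ) ^ n * ν.real (Set.Icc (-(2 * R)) (2 * R))ᶜ ≤ 1 := by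
      refine le_of_mul_le_mul_right ?_ hRn
      linarith
    rw [one_div, inv_pow, ← one_div, le_div_iff₀ (by positivity), mul_comm]
    norm_num at h4 ⊢
    exact h4
  have h0 : ν.real (Set.Icc (-(2 * R)) (2 * R))ᶜ = 0 := by
    refine le_antisymm (ge_of_tendsto' (tendsto_pow_atTop_nhds_zero_of_lt_one (r := (1 / 4 : ℝ))
      (by norm_num) (by norm_num)) hle) measureReal_nonneg
  exact (measureReal_eq_zero_iff).1 h0

theorem integral_eval_eq {μ ν : Measure ℝ} (hμ : ∀ n : ℕ, Integrable (fun t : ℝ => t ^ n) μ)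
    (hν : ∀ n : ℕ, Integrable (fun t : ℝ => t ^ n) ν)
    (h : ∀ n : ℕ, ∫ t, t ^ n ∂μ = ∫ t, t ^ n ∂ν) (p : Polynomial ℝ) :
    ∫ t, p.eval t ∂μ = ∫ t, p.eval t ∂ν := by
  simp only [Polynomial.eval_eq_sum_range]
  rw [integral_finsetSum _ fun n _ => (hμ n).const_mul _,
    integral_finsetSum _ fun n _ => (hν n).const_mul _]
  simp only [integral_const_mul, h]

/-- Equal even moments confine `ν` to a compact interval as well; there polynomials are uniformly
dense in the continuous functions by Weierstrass. No support condition on `ν` is needed. -/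
theorem eq_of_moments {μ ν : Measure ℝ} [IsProbabilityMeasure μ] [IsProbabilityMeasure ν] {R : ℝ}
    (hμ : μ (Set.Icc (-R) R)ᶜ = 0) (hν : ∀ n : ℕ, Integrable (fun t : ℝ => t ^ n) ν)
    (h : ∀ n : ℕ, ∫ t, t ^ n ∂μ = ∫ t, t ^ n ∂ν) : ν = μ := by
  obtain ⟨S, hS, hRS⟩ : ∃ S : ℝ, 0 < S ∧ R ≤ S := ⟨max R 1, by positivity, le_max_left _ _⟩
  have hμS : μ (Set.Icc (-S) S)ᶜ = 0 :=
    measure_mono_null (Set.compl_subset_compl.2 (Set.Icc_subset_Icc (by linarith) hRS)) hμ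
  have hμint : ∀ n : ℕ, Integrable (fun t : ℝ => t ^ n) μ := fun n =>
    integrable_of_compactSupport hμ (continuous_pow n)
  have hμ2 : μ (Set.Icc (-(2 * S)) (2 * S))ᶜ = 0 :=
    measure_mono_null
      (Set.compl_subset_compl.2 (Set.Icc_subset_Icc (by linarith) (by linarith))) hμS
  have hν2 : ν (Set.Icc (-(2 * S)) (2 * S))ᶜ = 0 := by
    refine measure_compl_Icc_eq_zero hS hν fun n => ?_
    rw [← h]
    calc ∫ t, t ^ (2 * n) ∂μ ≤ ∫ _t, S ^ (2 * n) ∂μ := by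
          refine integral_mono_ae (hμint _) (integrable_const _) ?_
          have hae : ∀ᵐ t ∂μ, t ∈ Set.Icc (-S) S := hμS
          filter_upwards [hae] with t ht
          rw [← Even.pow_abs (even_two_mul n) t]
          exact pow_le_pow_left₀ (abs_nonneg t) (abs_le.2 ht) _
      _ = S ^ (2 * n) := by simp
  refine ext_of_forall_integral_eq_of_IsFiniteMeasure fun f => ?_
  have happrox : ∀ ρ : Measure ℝ, IsProbabilityMeasure ρ →
      ρ (Set.Icc (-(2 * S)) (2 * S))ᶜ = 0 → ∀ ε > 0, ∀ p : Polynomial ℝ,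
      (∀ t ∈ Set.Icc (-(2 * S)) (2 * S), |p.eval t - f t| < ε) →
      |∫ t, p.eval t ∂ρ - ∫ t, f t ∂ρ| ≤ ε := by
    intro ρ _ hρ ε _ p hp
    rw [← integral_sub (integrable_of_compactSupport hρ p.continuous)
      (integrable_of_compactSupport hρ f.continuous), ← Real.norm_eq_abs]
    have hae : ∀ᵐ t ∂ρ, t ∈ Set.Icc (-(2 * S)) (2 * S) := hρ
    have := norm_integral_le_of_norm_le_const (μ := ρ) (f := fun t => p.eval t - f t) (C := ε) (by
      filter_upwards [hae] with t ht
      exact (hp t ht).le)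
    simpa using this
  by_contra hne
  have hpos : 0 < |∫ t, f t ∂ν - ∫ t, f t ∂μ| := abs_pos.2 (sub_ne_zero.2 hne)
  -- Replacing `f` by `p` costs at most a third of the supposed gap for each measure, and the
  -- integrals of `p` coincide.
  obtain ⟨p, hp⟩ := exists_polynomial_near_of_continuousOn (-(2 * S)) (2 * S) f
    f.continuous.continuousOn (|∫ t, f t ∂ν - ∫ t, f t ∂μ| / 3) (by positivity)
  have h1 := happrox μ inferInstance hμ2 _ (by positivity) p hp
  have h2 := happrox ν inferInstance hν2 _ (by positivity) p hp
  rw [integral_eval_eq hμint hν h] at h1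
  have h3 : |∫ t, f t ∂ν - ∫ t, f t ∂μ| ≤ |∫ t, p.eval t ∂ν - ∫ t, f t ∂μ| +
      |∫ t, p.eval t ∂ν - ∫ t, f t ∂ν| := by
    rw [← abs_neg (∫ t, p.eval t ∂ν - ∫ t, f t ∂ν)]
    refine le_trans (le_of_eq ?_) (abs_add_le _ _)
    congr 1
    ring
  linarith

/-! ### The spectral measure of a bounded selfadjoint operator -/

-- The functional f ↦ Re ⟨v, f(T) v⟩ on the continuous functions of the compact spectrum is positive
-- by the continuous functional calculus. Riesz–Markov represents it by a measure, which is pushed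
-- forward to ℝ.
open CompactlySupported in
theorem exists_spectralMeasure {E : Type*} [NormedAddCommGroup E] [InnerProductSpace ℂ E]
    [CompleteSpace E] {T : E →L[ℂ] E} (hT : IsSelfAdjoint T) {v : E} (hv : ‖v‖ = 1) :
    ∃ μ : Measure ℝ, IsProbabilityMeasure μ ∧ (∃ R : ℝ, μ (Set.Icc (-R) R)ᶜ = 0) ∧
      ∀ p : Polynomial ℝ, ∫ t, p.eval t ∂μ = (inner ℂ v (Polynomial.aeval T p v)).re := by
  have : Nontrivial E := ⟨v, 0, fun h => by simp [h] at hv⟩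
  let Λ₀ : C_c(spectrum ℝ T, ℝ) →ₗ[ℝ] ℝ :=
    { toFun := fun f => (inner ℂ v (cfcHom hT (f : C(spectrum ℝ T, ℝ)) v)).re
      map_add' := by
        intro f g
        have : ((f + g : C_c(spectrum ℝ T, ℝ)) : C(spectrum ℝ T, ℝ)) = f + g := by ext; rfl
        rw [this, map_add, add_apply, inner_add_right, Complex.add_re]
      map_smul' := by
        intro c f
        have : ((c • f : C_c(spectrum ℝ T, ℝ)) : C(spectrum ℝ T, ℝ)) =
          c • (f : C(spectrum ℝ T, ℝ)) := by ext; rfl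
        rw [this, map_smul, smul_apply, RingHom.id_apply, smul_eq_mul]
        have h2 : c • (cfcHom hT (f : C(spectrum ℝ T, ℝ)) v) =
          (c : ℂ) • (cfcHom hT (f : C(spectrum ℝ T, ℝ)) v) := rfl
        rw [h2, inner_smul_right, Complex.re_ofReal_mul] }
  let Λ : C_c(spectrum ℝ T, ℝ) →ₚ[ℝ] ℝ := PositiveLinearMap.mk₀ Λ₀ (by
    intro f hf
    have h1 : 0 ≤ cfcHom hT (f : C(spectrum ℝ T, ℝ)) :=
      (cfcHom_nonneg_iff hT).2 fun x => hf x
    have h2 := ((ContinuousLinearMap.nonneg_iff_isPositive _).1 h1).re_inner_nonneg_right v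
    exact h2)
  have hint : ∀ p : Polynomial ℝ, ∫ x : spectrum ℝ T, p.eval (x : ℝ) ∂(RealRMK.rieszMeasure Λ) =
      (inner ℂ v (Polynomial.aeval T p v)).re := by
    intro p
    let g : C(spectrum ℝ T, ℝ) := ContinuousMap.restrict (spectrum ℝ T) (ContinuousMap.id ℝ)
    have h := RealRMK.integral_rieszMeasure Λ
      (CompactlySupportedContinuousMap.continuousMapEquiv (Polynomial.aeval g p))
    have h1 : Λ (CompactlySupportedContinuousMap.continuousMapEquiv (Polynomial.aeval g p)) =
        (inner ℂ v (cfcHom hT (Polynomial.aeval g p) v)).re := rfl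
    have h2 : cfcHom hT (Polynomial.aeval g p) = Polynomial.aeval T p := by
      have := Polynomial.aeval_algHom_apply (cfcHom hT : C(spectrum ℝ T, ℝ) →⋆ₐ[ℝ] _).toAlgHom g p
      have h3 : (cfcHom hT : C(spectrum ℝ T, ℝ) →⋆ₐ[ℝ] _).toAlgHom g = T := cfcHom_id hT
      rw [h3] at this
      exact this.symm
    rw [h1, h2] at h
    rw [← h]
    refine integral_congr_ae (Filter.Eventually.of_forall fun x => ?_)
    change p.eval (x : ℝ) = (Polynomial.aeval g p) x
    rw [Polynomial.aeval_continuousMap_apply]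
    rfl
  have hprob : IsProbabilityMeasure (RealRMK.rieszMeasure Λ) := by
    have h := hint 1
    simp only [Polynomial.eval_one, integral_const, smul_eq_mul, mul_one, map_one,
      one_apply_eq_self] at h
    rw [inner_self_eq_norm_sq_to_K, hv] at h
    constructor
    have h' : (RealRMK.rieszMeasure Λ).real Set.univ = 1 := by rw [h]; simp
    rw [measureReal_def] at h'
    rw [← ENNReal.toReal_eq_one_iff]
    exact h'
  have hmeas : Measurable (Subtype.val : spectrum ℝ T → ℝ) := measurable_subtype_coe
  refine ⟨(RealRMK.rieszMeasure Λ).map Subtype.val, Measure.isProbabilityMeasure_map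
    hmeas.aemeasurable, ⟨‖T‖, ?_⟩, fun p => ?_⟩
  · rw [Measure.map_apply hmeas measurableSet_Icc.compl]
    convert measure_empty (μ := RealRMK.rieszMeasure Λ)
    ext x
    simp only [Set.mem_preimage, Set.mem_compl_iff, Set.mem_empty_iff_false, iff_false, not_not]
    exact abs_le.1 (spectrum.norm_le_norm_of_mem x.2)
  · rw [integral_map hmeas.aemeasurable p.continuous.aestronglyMeasurable, hint]

/-! ### Jacobi operators and orthogonal polynomials -/

/-- The Hilbert space `ℓ²(ℕ)`. -/
abbrev SeqSpace : Type := lp (fun _ : ℕ => ℂ) 2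

theorem seqSpace_summable (f : SeqSpace) : Summable fun n => ‖f n‖ ^ 2 := by
  simpa using (lp.hasSum_norm (by norm_num) f).summable

theorem seqSpace_norm_sq (f : SeqSpace) : ‖f‖ ^ 2 = ∑' n, ‖f n‖ ^ 2 := by
  simpa using lp.norm_rpow_eq_tsum (by norm_num) f

/-- The sequence `0, a_0 f_0, a_1 f_1, …`. -/
def shiftSeq (a : ℕ → ℝ) (f : ℕ → ℂ) : ℕ → ℂ
  | 0 => 0
  | n + 1 => a n * f n

theorem shiftSeq_summable {a : ℕ → ℝ} {C : ℝ} (ha : ∀ n, |a n| ≤ C) (f : SeqSpace) :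
    Summable fun n => ‖shiftSeq a f n‖ ^ 2 := by
  rw [← summable_nat_add_iff 1]
  refine Summable.of_nonneg_of_le (fun n => by positivity) (fun n => ?_)
    ((seqSpace_summable f).mul_left (C ^ 2))
  simp only [shiftSeq, norm_mul, Complex.norm_real, Real.norm_eq_abs, mul_pow]
  gcongr
  exact ha n

theorem tsum_shiftSeq_le {a : ℕ → ℝ} {C : ℝ} (ha : ∀ n, |a n| ≤ C) (f : SeqSpace) :
    ∑' n, ‖shiftSeq a f n‖ ^ 2 ≤ C ^ 2 * ‖f‖ ^ 2 := by
  rw [(shiftSeq_summable ha f).tsum_eq_zero_add, seqSpace_norm_sq, ← tsum_mul_left]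
  simp only [shiftSeq, norm_zero, norm_mul, Complex.norm_real, Real.norm_eq_abs, mul_pow]
  rw [zero_pow two_ne_zero, zero_add]
  refine Summable.tsum_le_tsum (fun n => ?_) ?_ ((seqSpace_summable f).mul_left _)
  · gcongr
    exact ha n
  · have := (summable_nat_add_iff 1).2 (shiftSeq_summable ha f)
    simpa only [shiftSeq, norm_mul, Complex.norm_real, Real.norm_eq_abs, mul_pow] using this

/-- The weighted shift `e_n ↦ a_n e_{n+1}` of `ℓ²(ℕ)`, for bounded weights. -/
def weightedShift (a : ℕ → ℝ) (C : ℝ) (ha : ∀ n, |a n| ≤ C) : SeqSpace →L[ℂ] SeqSpace :=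
  LinearMap.mkContinuous
    { toFun := fun f => ⟨shiftSeq a f, memℓp_gen (by simpa using shiftSeq_summable ha f)⟩
      map_add' := by
        intro f g
        ext n
        change shiftSeq a (⇑f + ⇑g) n = shiftSeq a f n + shiftSeq a g n
        cases n <;> simp [shiftSeq, mul_add]
      map_smul' := by
        intro c f
        ext n
        cases n
        · simp [shiftSeq]
        · simp [shiftSeq]; ring }
    C (by
      intro f
      have hC : 0 ≤ C := (abs_nonneg _).trans (ha 0)
      refine le_of_sq_le_sq ?_ (by positivity)
      rw [mul_pow, seqSpace_norm_sq]
      exact tsum_shiftSeq_le ha f)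

theorem weightedShift_apply {a : ℕ → ℝ} {C : ℝ} (ha : ∀ n, |a n| ≤ C) (f : SeqSpace) (n : ℕ) :
    weightedShift a C ha f n = shiftSeq a f n := rfl

/-- The standard basis vectors of `ℓ²(ℕ)`. -/
def basisVec (n : ℕ) : SeqSpace := lp.single 2 n 1

theorem basisVec_apply (n m : ℕ) : basisVec n m = if m = n then 1 else 0 := by
  rw [basisVec, lp.single_apply]
  split_ifs with h
  · subst h; simp
  · simp [Pi.single_eq_of_ne h]

theorem inner_basisVec (n : ℕ) (f : SeqSpace) : inner ℂ (basisVec n) f = f n := by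
  rw [basisVec, lp.inner_single_left]
  simp

theorem weightedShift_basisVec {a : ℕ → ℝ} {C : ℝ} (ha : ∀ n, |a n| ≤ C) (n : ℕ) :
    weightedShift a C ha (basisVec n) = (a n : ℂ) • basisVec (n + 1) := by
  ext m
  rw [weightedShift_apply, lp.coeFn_smul, Pi.smul_apply, basisVec_apply]
  cases m with
  | zero => simp [shiftSeq]
  | succ m =>
    rw [shiftSeq, basisVec_apply]
    by_cases h : m = n <;> simp [h]

/-- The Jacobi operator with off-diagonal entries `a_n`. -/
def jacobiOp (a : ℕ → ℝ) (C : ℝ) (ha : ∀ n, |a n| ≤ C) : SeqSpace →L[ℂ] SeqSpace :=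
  weightedShift a C ha + star (weightedShift a C ha)

theorem star_weightedShift_apply {a : ℕ → ℝ} {C : ℝ} (ha : ∀ n, |a n| ≤ C) (f : SeqSpace) (n : ℕ) :
    star (weightedShift a C ha) f n = a n * f (n + 1) := by
  rw [← inner_basisVec, ContinuousLinearMap.star_eq_adjoint,
    ContinuousLinearMap.adjoint_inner_right, weightedShift_basisVec, inner_smul_left,
    inner_basisVec, Complex.conj_ofReal]

theorem jacobiOp_basisVec_zero {a : ℕ → ℝ} {C : ℝ} (ha : ∀ n, |a n| ≤ C) :
    jacobiOp a C ha (basisVec 0) = (a 0 : ℂ) • basisVec 1 := by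
  rw [jacobiOp, add_apply, weightedShift_basisVec, add_eq_left]
  ext m
  rw [star_weightedShift_apply, basisVec_apply]
  simp

theorem jacobiOp_basisVec_succ {a : ℕ → ℝ} {C : ℝ} (ha : ∀ n, |a n| ≤ C) (n : ℕ) :
    jacobiOp a C ha (basisVec (n + 1)) =
      (a (n + 1) : ℂ) • basisVec (n + 2) + (a n : ℂ) • basisVec n := by
  rw [jacobiOp, add_apply, weightedShift_basisVec, add_right_inj]
  ext m
  rw [star_weightedShift_apply, basisVec_apply, lp.coeFn_smul, Pi.smul_apply, basisVec_apply]
  by_cases h : m = n <;> simp [h]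

theorem isSelfAdjoint_aeval {E : Type*} [NormedAddCommGroup E] [InnerProductSpace ℂ E]
    [CompleteSpace E] {T : E →L[ℂ] E} (hT : IsSelfAdjoint T) (p : Polynomial ℝ) :
    IsSelfAdjoint (Polynomial.aeval T p) := by
  rw [Polynomial.aeval_eq_sum_range]
  exact isSelfAdjoint_sum _ fun n _ => IsSelfAdjoint.smul (IsSelfAdjoint.all _) (hT.pow n)

/-- The orthogonality measure of the polynomials of a Jacobi operator. -/
theorem exists_orthogonality_measure_of_jacobi {E : Type*} [NormedAddCommGroup E]
    [InnerProductSpace ℂ E] [CompleteSpace E] {T : E →L[ℂ] E} (hT : IsSelfAdjoint T) {b : ℕ → E}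
    (hb : Orthonormal ℂ b) {w : ℕ → ℝ} (hw : ∀ n, 0 ≤ w n)
    (hT0 : T (b 0) = ((Real.sqrt (w 0) : ℝ) : ℂ) • b 1)
    (hTs : ∀ n, T (b (n + 1)) =
      ((Real.sqrt (w (n + 1)) : ℝ) : ℂ) • b (n + 2) + ((Real.sqrt (w n) : ℝ) : ℂ) • b n)
    {P : ℕ → Polynomial ℝ} (h0 : P 0 = 1) (h1 : P 1 = Polynomial.X)
    (hrec : ∀ n, P (n + 2) = Polynomial.X * P (n + 1) - Polynomial.C (w n) * P n) :
    ∃ μ : Measure ℝ, IsProbabilityMeasure μ ∧ (∃ R : ℝ, μ (Set.Icc (-R) R)ᶜ = 0) ∧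
      ∀ m n, ∫ t, (P m).eval t * (P n).eval t ∂μ =
        if m = n then ∏ i ∈ Finset.range n, w i else 0 := by
  have hsq : ∀ n, ((Real.sqrt (w n) : ℝ) : ℂ) * (Real.sqrt (w n) : ℝ) = (w n : ℝ) := fun n => by
    rw [← Complex.ofReal_mul, Real.mul_self_sqrt (hw n)]
  -- The square roots normalize the monic polynomials: applied to `b 0`, they reproduce the basis up
  -- to the factor √(w_0 ⋯ w_{n-1}).
  have hP : ∀ n, Polynomial.aeval T (P n) (b 0) =
      ((∏ i ∈ Finset.range n, Real.sqrt (w i) : ℝ) : ℂ) • b n := by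
    intro n
    induction n using Nat.strong_induction_on with
    | _ n ih =>
      match n with
      | 0 => simp [h0]
      | 1 =>
        rw [h1, Polynomial.aeval_X, hT0]
        simp
      | n + 2 =>
        have hsmul : ∀ (r : ℝ) (u : E), (algebraMap ℝ (E →L[ℂ] E) r) u = (r : ℂ) • u :=
          fun r u => rfl
        rw [hrec, map_sub, map_mul, map_mul, Polynomial.aeval_X, Polynomial.aeval_C,
          sub_apply, mul_apply_eq_comp, mul_apply_eq_comp,
          ih (n + 1) (by omega), ih n (by omega), hsmul, map_smul,
          hTs, smul_add, smul_smul, smul_smul, smul_smul,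
          Finset.prod_range_succ _ (n + 1), Finset.prod_range_succ _ n]
        push_cast
        rw [mul_assoc _ (Real.sqrt (w n) : ℂ) (Real.sqrt (w n) : ℂ), hsq, mul_comm (w n : ℂ)]
        exact add_sub_cancel_right _ _
  obtain ⟨μ, hμ, hsupp, hint⟩ := exists_spectralMeasure hT (hb.1 0)
  refine ⟨μ, hμ, hsupp, fun m n => ?_⟩
  have h := hint (P m * P n)
  simp only [Polynomial.eval_mul] at h
  have hinner : inner ℂ (b 0) (Polynomial.aeval T (P m * P n) (b 0)) =
      inner ℂ (Polynomial.aeval T (P m) (b 0)) (Polynomial.aeval T (P n) (b 0)) := by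
    rw [map_mul, mul_apply_eq_comp,
      ← ContinuousLinearMap.adjoint_inner_left, ← ContinuousLinearMap.star_eq_adjoint,
      (isSelfAdjoint_aeval hT (P m)).star_eq]
  rw [h, hinner, hP, hP, inner_smul_left, inner_smul_right, orthonormal_iff_ite.1 hb,
    Complex.conj_ofReal]
  split_ifs with hmn
  · subst hmn
    rw [mul_one, ← Complex.ofReal_mul, Complex.ofReal_re, ← Finset.prod_mul_distrib]
    exact Finset.prod_congr rfl fun i _ => Real.mul_self_sqrt (hw i)
  · simp

/-- Favard's theorem for bounded recursion coefficients. -/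
theorem exists_orthogonality_measure {w : ℕ → ℝ} (hw : ∀ n, 0 ≤ w n) {C : ℝ} (hC : ∀ n, w n ≤ C)
    {P : ℕ → Polynomial ℝ} (h0 : P 0 = 1) (h1 : P 1 = Polynomial.X)
    (hrec : ∀ n, P (n + 2) = Polynomial.X * P (n + 1) - Polynomial.C (w n) * P n) :
    ∃ μ : Measure ℝ, IsProbabilityMeasure μ ∧ (∃ R : ℝ, μ (Set.Icc (-R) R)ᶜ = 0) ∧
      ∀ m n, ∫ t, (P m).eval t * (P n).eval t ∂μ =
        if m = n then ∏ i ∈ Finset.range n, w i else 0 := by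
  have ha : ∀ n, |Real.sqrt (w n)| ≤ Real.sqrt C := fun n => by
    rw [abs_of_nonneg (Real.sqrt_nonneg _)]
    exact Real.sqrt_le_sqrt (hC n)
  have hb : Orthonormal ℂ basisVec := orthonormal_iff_ite.2 fun m n => by
    rw [inner_basisVec, basisVec_apply]
  exact exists_orthogonality_measure_of_jacobi (IsSelfAdjoint.add_star_self _) hb hw
    (jacobiOp_basisVec_zero ha) (jacobiOp_basisVec_succ ha) h0 h1 hrec

/-! ### The polynomials `polyD` -/

theorem qNumber_pos {q : ℝ} (hq : q ∈ Set.Ioo (-1 : ℝ) 1) (n : ℕ) : 0 < qNumber q (n + 1) := by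
  have h1 : qNumber q (n + 1) * (1 - q) = 1 - q ^ (n + 1) := geom_sum_mul_neg q (n + 1)
  have h2 : q ^ (n + 1) < 1 :=
    (le_abs_self _).trans_lt (by
      rw [abs_pow]
      exact pow_lt_one₀ (abs_nonneg q) (abs_lt.2 hq) (Nat.succ_ne_zero n))
  refine pos_of_mul_pos_left (b := 1 - q) ?_ (by linarith [hq.2])
  rw [h1]
  linarith

theorem jacobiCoeff_pos {q : ℝ} (hq : q ∈ Set.Ioo (-1 : ℝ) 1) (n : ℕ) : 0 < jacobiCoeff q n := by
  cases n with
  | zero => exact one_pos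
  | succ n =>
    refine mul_pos (qNumber_pos hq (n + 1)) ?_
    have h2 : |q ^ (n + 1)| < 1 := by
      rw [abs_pow]
      exact pow_lt_one₀ (abs_nonneg q) (abs_lt.2 hq) (Nat.succ_ne_zero n)
    linarith [(abs_lt.1 h2).1]

/-- The geometric series bounds [n]_q by 1/(1-|q|), and the other factor is at most 2. This
boundedness yields a bounded Jacobi operator and compact support. -/
theorem jacobiCoeff_le {q : ℝ} (hq : q ∈ Set.Ioo (-1 : ℝ) 1) (n : ℕ) :
    jacobiCoeff q n ≤ 2 / (1 - |q|) := by
  have hq1 : |q| < 1 := abs_lt.2 hq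
  have hpos : 0 < 1 - |q| := by linarith
  cases n with
  | zero =>
    rw [le_div_iff₀ hpos, jacobiCoeff]
    linarith [abs_nonneg q]
  | succ n =>
    have h1 : qNumber q (n + 2) ≤ 1 / (1 - |q|) := by
      have h2 : qNumber q (n + 2) ≤ ∑ i ∈ Finset.range (n + 2), |q| ^ i :=
        Finset.sum_le_sum fun i _ => (le_abs_self _).trans (abs_pow q i).le
      refine h2.trans ?_
      rw [le_div_iff₀ hpos, geom_sum_mul_neg]
      linarith [pow_nonneg (abs_nonneg q) (n + 2)]
    have h3 : q ^ (n + 1) ≤ 1 :=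
      (le_abs_self _).trans (by rw [abs_pow]; exact pow_le_one₀ (abs_nonneg q) hq1.le)
    have h4 := qNumber_pos hq (n + 1)
    calc jacobiCoeff q (n + 1) ≤ qNumber q (n + 2) * 2 :=
          mul_le_mul_of_nonneg_left (by linarith) h4.le
      _ ≤ 1 / (1 - |q|) * 2 := by linarith
      _ = 2 / (1 - |q|) := by ring

theorem polyD_monic_natDegree (q : ℝ) (n : ℕ) : (polyD q n).Monic ∧ (polyD q n).natDegree = n := by
  induction n using Nat.strong_induction_on with
  | _ n ih =>
    match n with
    | 0 => exact ⟨Polynomial.monic_one, Polynomial.natDegree_one⟩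
    | 1 => exact ⟨Polynomial.monic_X, Polynomial.natDegree_X⟩
    | n + 2 =>
      obtain ⟨hm, hd⟩ := ih (n + 1) (by omega)
      obtain ⟨_, hd'⟩ := ih n (by omega)
      have hXm : (Polynomial.X * polyD q (n + 1)).Monic := Polynomial.monic_X.mul hm
      have hXd : (Polynomial.X * polyD q (n + 1)).natDegree = n + 2 := by
        rw [Polynomial.monic_X.natDegree_mul hm, hd, Polynomial.natDegree_X]
        omega
      have hlt : (Polynomial.C (jacobiCoeff q n) * polyD q n).degree <
          (Polynomial.X * polyD q (n + 1)).degree := by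
        refine Polynomial.degree_lt_degree ?_
        rw [hXd]
        exact (Polynomial.natDegree_C_mul_le _ _).trans_lt (by omega)
      rw [polyD_succ_succ]
      exact ⟨hXm.sub_of_left hlt, by
        rw [Polynomial.natDegree_eq_of_degree_eq (Polynomial.degree_sub_eq_left_of_degree_lt hlt),
          hXd]⟩

/-! ### Moment functionals compared on the `polyD` basis -/

theorem linearMap_ext_polyD (q : ℝ) {M : Type*} [AddCommGroup M] [Module ℝ M]
    {φ ψ : Polynomial ℝ →ₗ[ℝ] M} (h : ∀ n, φ (polyD q n) = ψ (polyD q n)) : φ = ψ := by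
  let S : Polynomial.Sequence ℝ := ⟨polyD q, fun n => by
    rw [Polynomial.degree_eq_natDegree (polyD_monic_natDegree q n).1.ne_zero,
      (polyD_monic_natDegree q n).2]⟩
  have hS : ∀ n, IsUnit (S n).leadingCoeff := fun n => by
    have : (S n).leadingCoeff = 1 := (polyD_monic_natDegree q n).1
    rw [this]
    exact isUnit_one
  refine LinearMap.ext_on_range (S.span hS) h

/-- The moment functional of a measure. -/
def momentFunctional (μ : Measure ℝ) (hμ : ∀ n : ℕ, Integrable (fun t : ℝ => t ^ n) μ) :
    Polynomial ℝ →ₗ[ℝ] ℝ where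
  toFun p := ∫ t, p.eval t ∂μ
  map_add' p r := by
    simp only [Polynomial.eval_add]
    refine integral_add ?_ ?_ <;> simp only [Polynomial.eval_eq_sum_range] <;>
      exact integrable_finsetSum _ fun n _ => (hμ n).const_mul _
  map_smul' c p := by
    simp only [Polynomial.eval_smul, smul_eq_mul, RingHom.id_apply]
    exact integral_const_mul _ _

theorem momentFunctional_X_pow (μ : Measure ℝ) (hμ : ∀ n : ℕ, Integrable (fun t : ℝ => t ^ n) μ)
    (n : ℕ) : momentFunctional μ hμ (Polynomial.X ^ n) = ∫ t, t ^ n ∂μ := by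
  simp [momentFunctional]

theorem momentFunctional_polyD {q : ℝ} {μ : Measure ℝ} [IsProbabilityMeasure μ]
    (hμ : IsMonicOrthogonal μ (polyD q)) (n : ℕ) :
    momentFunctional μ hμ.integrable (polyD q n) = if n = 0 then 1 else 0 := by
  change ∫ t, (polyD q n).eval t ∂μ = _
  split_ifs with h
  · subst h
    simp [polyD]
  · have := hμ.orthogonal 0 n (Ne.symm h)
    simpa [polyD] using this

/-- The functional `p ↦ ⟨Ω, p(G) Ω⟩_q` on real polynomials. -/
def vacuumFunctional (q : ℝ) (J : H →L[ℂ] H) (x : H) : Polynomial ℝ →ₗ[ℝ] ℂ where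
  toFun p := fockInner q J vacuum
    (Polynomial.aeval (gaussian q J x) (p.map (algebraMap ℝ ℂ)) vacuum)
  map_add' p r := by
    rw [Polynomial.map_add, map_add, LinearMap.add_apply, map_add]
  map_smul' c p := by
    rw [Polynomial.map_smul, map_smul, LinearMap.smul_apply, map_smul]
    simp

theorem integral_polyD_unique {q : ℝ} {μ ν : Measure ℝ} [IsProbabilityMeasure μ]
    [IsProbabilityMeasure ν] (hμ : IsMonicOrthogonal μ (polyD q))
    (hν : IsMonicOrthogonal ν (polyD q)) (n : ℕ) : ∫ t, t ^ n ∂μ = ∫ t, t ^ n ∂ν := by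
  have h : momentFunctional μ hμ.integrable = momentFunctional ν hν.integrable :=
    linearMap_ext_polyD q fun n => by rw [momentFunctional_polyD hμ, momentFunctional_polyD hν]
  rw [← momentFunctional_X_pow μ hμ.integrable, h, momentFunctional_X_pow]

theorem exists_isMonicOrthogonal_polyD {q : ℝ} (hq : q ∈ Set.Ioo (-1 : ℝ) 1) :
    ∃ μ : Measure ℝ, IsProbabilityMeasure μ ∧ (∃ R : ℝ, μ (Set.Icc (-R) R)ᶜ = 0) ∧
      IsMonicOrthogonal μ (polyD q) := by
  obtain ⟨μ, hμ, ⟨R, hR⟩, hint⟩ := exists_orthogonality_measure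
    (fun n => (jacobiCoeff_pos hq n).le) (jacobiCoeff_le hq) (P := polyD q) rfl rfl
    (polyD_succ_succ q)
  refine ⟨μ, hμ, ⟨R, hR⟩, fun n => integrable_of_compactSupport hR (continuous_pow n),
    fun n => (polyD_monic_natDegree q n).1, fun n => (polyD_monic_natDegree q n).2,
    fun m n hmn => by rw [hint, if_neg hmn], fun n => ?_⟩
  simp only [sq]
  rw [hint, if_pos rfl]
  exact Finset.prod_pos fun i _ => jacobiCoeff_pos hq i

/-- Both functionals send P_n to δ_{n,0}: the integral by orthogonality to P_0 = 1, the vacuum state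
because P_n(G) Ω lies in degree n. -/
theorem hasVacuumMoments_of_isMonicOrthogonal {q : ℝ} (hq : q ∈ Set.Ioo (-1 : ℝ) 1)
    {J : H →L[ℂ] H} (hJ : ∀ y, J (J y) = y) (hJ' : ∀ x y, inner ℂ (J x) (J y) = inner ℂ x y)
    {x : H} (hx_norm : ‖x‖ = 1) (hx : J x = x ∨ J x = -x) {μ : Measure ℝ} [IsProbabilityMeasure μ]
    (hμ : IsMonicOrthogonal μ (polyD q)) : HasVacuumMoments q J x μ := by
  have h : Complex.ofRealCLM.toLinearMap ∘ₗ momentFunctional μ hμ.integrable = vacuumFunctional q J x := by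
    refine linearMap_ext_polyD q fun n => ?_
    rw [LinearMap.comp_apply, momentFunctional_polyD hμ]
    change _ = fockInner q J vacuum _
    rw [aeval_polyD_vacuum hq hJ hJ' hx_norm hx, fockInner_vacuum_tensorPow q hx]
    split_ifs <;> simp
  intro n
  refine ⟨hμ.integrable n, ?_⟩
  have h2 := LinearMap.congr_fun h (Polynomial.X ^ n)
  rw [LinearMap.comp_apply, momentFunctional_X_pow] at h2
  refine h2.trans ?_
  change fockInner q J vacuum _ = _
  rw [Polynomial.map_pow, Polynomial.map_X, map_pow, Polynomial.aeval_X]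

end TypeDFock

end

theorem mainTheorem3 {H : Type*} [NormedAddCommGroup H] [InnerProductSpace ℂ H] [CompleteSpace H]
    (J : H →L[ℂ] H) (hJ_selfAdjoint : IsSelfAdjoint J) (hJ_involutive : ∀ y, J (J y) = y)
    (q : ℝ) (hq : q ∈ Set.Ioo (-1 : ℝ) 1)
    (x : H) (hx_norm : ‖x‖ = 1) (hx_eigen : J x = x ∨ J x = -x) :
    -- the form `⟨·, ·⟩_q` is an inner product and `d_q(x)` is the adjoint of `d_q^*(x)` for it
    (∀ f : TypeDFock.Fock H, f ≠ 0 →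
      0 < (TypeDFock.fockInner q J f f).re ∧ (TypeDFock.fockInner q J f f).im = 0) ∧
    TypeDFock.IsAdjointOfCreation q J x (TypeDFock.annihilation q J x) ∧
    -- there is exactly one probability measure `μ_q` with the orthogonal polynomials `P_n`,
    -- and it is the vacuum distribution of `G_q(x)`
    ∃ μ : MeasureTheory.Measure ℝ, MeasureTheory.IsProbabilityMeasure μ ∧
      TypeDFock.IsMonicOrthogonal μ (TypeDFock.polyD q) ∧
      (∀ ν : MeasureTheory.Measure ℝ, MeasureTheory.IsProbabilityMeasure ν →
        TypeDFock.IsMonicOrthogonal ν (TypeDFock.polyD q) → ν = μ) ∧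
      TypeDFock.IsVacuumDistribution q J x μ := by
  have hJ' : ∀ x y, inner ℂ (J x) (J y) = inner ℂ x y := fun x y => by
    rw [← ContinuousLinearMap.adjoint_inner_right, ← ContinuousLinearMap.star_eq_adjoint,
      hJ_selfAdjoint.star_eq, hJ_involutive]
  refine ⟨fun f hf => TypeDFock.fockInner_self hq J hJ_involutive hJ' hf,
    TypeDFock.isAdjointOfCreation_annihilation hq J hJ_involutive hJ' x, ?_⟩
  obtain ⟨μ, hμ, ⟨R, hR⟩, horth⟩ := TypeDFock.exists_isMonicOrthogonal_polyD hq
  have hmom := TypeDFock.hasVacuumMoments_of_isMonicOrthogonal hq hJ_involutive hJ' hx_norm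
    hx_eigen horth
  refine ⟨μ, hμ, horth, fun ν hν hν' => ?_, hμ, ⟨R, hR⟩, hmom, fun ν hν hν' => ?_⟩
  · exact TypeDFock.eq_of_moments hR hν'.integrable (TypeDFock.integral_polyD_unique horth hν')
  · refine TypeDFock.eq_of_moments hR (fun n => (hν' n).1) fun n => ?_
    exact Complex.ofReal_injective ((hmom n).2.trans (hν' n).2.symm)
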